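/- **Conventions.** Let $K$ be a field, $Q$ a finite quiver and $\Lambda=KQ/I$, where $I$ is an admissible ideal of the path algebra, i.e. $J^n\subseteq I\subseteq J^2$ for some $n\ge 2$, with $J$ the ideal generated by the arrows. Paths are composed from left to right and modules are right modules. A full subquiver is identified with its set of vertices. Let $X$ be the set of vertices lying on a nontrivial oriented cycle of $Q$; the *homological heart* $H$ consists of $X$ together with all vertices on paths that begin and end in $X$. Let $H^+$ (resp. $H^-$) be the set of vertices $v\notin H$ such that there is a path from $H$ to $v$ (resp. from $v$ to $H$), and $H^0$ the set of vertices $v\notin H$ with no path between $v$ and $H$ in either direction. Let $\Gamma=\Lambda/\langle e'\rangle$, where $e'$ is the sum of the vertices not in $H$, and let $t$ be the length of the longest path of $Q$ all of whose vertices lie in $H^+\cup H^-\cup H^0$ ($t=0$ if there is none). A module $C$ has support in a set $S$ of vertices if $Cv=0$ for all vertices $v\notin S$. For a $\Lambda$-module $C$ let $C^+$ be its largest submodule with support in $H^+$, and $C_-$ its smallest submodule such that $C/C_-$ has support in $H^-$. Let $\operatorname{gl.dim}$ be the supremum of the projective dimensions of all modules and $\operatorname{fin.dim}$ the supremum of the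 projective dimensions of the finitely generated modules of finite projective dimension (the zero module counts as having dimension $0$). **Theorem.** 1. $\operatorname{gl.dim}\Lambda<\infty$ if and only if $\operatorname{gl.dim}\Gamma<\infty$. 2. $\operatorname{fin.dim}\Lambda<\infty$ if and only if $\operatorname{fin.dim}\Gamma<\infty$; moreover $\operatorname{fin.dim}\Lambda\le\operatorname{fin.dim}\Gamma+2t+2$. 3. Every $\Lambda$-module has a minimal projective resolution and a minimal injective coresolution. For $\Lambda$-modules $M$ and $N$ and any such resolutions, let $\Omega^{t+1}(M)$ be the $(t+1)$-st syzygy of $M$ and $\Omega^{-t-1}(N)$ the $(t+1)$-st cosyzygy of $N$. Then $$A_M=\Omega^{t+1}(M)/\bigl(\Omega^{t+1}(M)\bigr)^+\quad\text{and}\quad B_N=\bigl(\Omega^{-t-1}(N)\bigr)_-$$ are annihilated by $\langle e'\rangle$, hence are $\Gamma$-modules, and for all $\ell\ge 2t+3$ there are $K$-linear isomorphisms $$\operatorname{Ext}^{\ell}_{\Lambda}(M,N)\;\cong\;\operatorname{Ext}^{\ell-2t-2}_{\Gamma}(A_M,B_N)$$ that are natural in $M$ and $N$: they are compatible with all homomorphisms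 $f\colon M'\to M$ and $g\colon N\to N'$ and with the maps $A_{M'}\to A_M$ and $B_N\to B_{N'}$ induced by any lifts of $f$ and $g$ to (co)chain maps between the chosen resolutions. -/

import Mathlib

open CategoryTheory CategoryTheory.Abelian

universe u

noncomputable section

/-! ### Path algebras -/

/-- The type of all paths of a quiver, with their origin and terminus. -/
abbrev QuiverPath (V : Type u) [Quiver.{u, u} V] : Type u :=
  Σ (a : V) (b : V), Quiver.Path a b

/-- The path algebra `K Q`: the `K`-vector space with basis the paths of the quiver. -/
def PathAlgebra (K : Type u) [Field K] (V : Type u) [Quiver.{u, u} V] : Type u :=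
  QuiverPath V →₀ K

namespace PathAlgebra

variable {K : Type u} [Field K] {V : Type u} [Quiver.{u, u} V]

instance : AddCommGroup (PathAlgebra K V) := inferInstanceAs (AddCommGroup (QuiverPath V →₀ K))

instance : Module K (PathAlgebra K V) := inferInstanceAs (Module K (QuiverPath V →₀ K))

/-- A path, as a basis element of the path algebra. -/
def ofPath (p : QuiverPath V) : PathAlgebra K V := Finsupp.single p (1 : K)

open Classical in
/-- The product of two paths: the concatenation "first `p`, then `q`" if `p` ends where `q`
starts, and zero otherwise. -/
def pathMul (p q : QuiverPath V) : PathAlgebra K V :=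
  if h : p.2.1 = q.1 then ofPath ⟨p.1, q.2.1, p.2.2.comp (q.2.2.cast h.symm rfl)⟩ else 0

/-- The bilinear extension of the product of paths. -/
def mulLin : PathAlgebra K V →ₗ[K] PathAlgebra K V →ₗ[K] PathAlgebra K V :=
  Finsupp.lift (PathAlgebra K V →ₗ[K] PathAlgebra K V) K (QuiverPath V) (fun p =>
    Finsupp.lift (PathAlgebra K V) K (QuiverPath V) (fun q => pathMul p q))

instance : Mul (PathAlgebra K V) := ⟨fun x y => mulLin x y⟩

/-- The idempotent of the path algebra given by the trivial path at a vertex. -/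
def vertex (v : V) : PathAlgebra K V := ofPath ⟨v, v, Quiver.Path.nil⟩

/-- An arrow, as an element of the path algebra. -/
def arrow {a b : V} (f : a ⟶ b) : PathAlgebra K V := ofPath ⟨a, b, f.toPath⟩

instance [Fintype V] : One (PathAlgebra K V) := ⟨∑ v : V, vertex v⟩

theorem mul_def (x y : PathAlgebra K V) : x * y = mulLin x y := rfl

theorem one_def [Fintype V] : (1 : PathAlgebra K V) = ∑ v : V, vertex v := rfl

theorem ofPath_mul_ofPath (p q : QuiverPath V) :
    (ofPath p * ofPath q : PathAlgebra K V) = pathMul p q := by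
  let G : QuiverPath V → PathAlgebra K V →ₗ[K] PathAlgebra K V := fun p =>
    Finsupp.lift (PathAlgebra K V) K (QuiverPath V) (fun q => pathMul p q)
  have h1 : mulLin (ofPath p : PathAlgebra K V) = G p := by
    change (Finsupp.single p (1 : K)).sum (fun p c => c • G p) = G p
    rw [Finsupp.sum_single_index (by rw [zero_smul]), one_smul]
  rw [mul_def, h1]
  change (Finsupp.single q (1 : K)).sum (fun q c => c • pathMul p q) = pathMul p q
  rw [Finsupp.sum_single_index (by rw [zero_smul]), one_smul]

theorem ofPath_comp {a b c : V} (p : Quiver.Path a b) (q : Quiver.Path b c) :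
    (ofPath ⟨a, b, p⟩ * ofPath ⟨b, c, q⟩ : PathAlgebra K V) = ofPath ⟨a, c, p.comp q⟩ := by
  rw [ofPath_mul_ofPath, pathMul, dif_pos rfl]
  rfl

theorem ofPath_mul_of_ne {a b c d : V} (p : Quiver.Path a b) (q : Quiver.Path c d) (h : b ≠ c) :
    (ofPath ⟨a, b, p⟩ * ofPath ⟨c, d, q⟩ : PathAlgebra K V) = 0 := by
  rw [ofPath_mul_ofPath, pathMul, dif_neg h]

/-- Two linear maps on the path algebra agree if they agree on paths. -/
theorem lin_ext {W : Type*} [AddCommGroup W] [Module K W] {f g : PathAlgebra K V →ₗ[K] W}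
    (h : ∀ p, f (ofPath p) = g (ofPath p)) : f = g :=
  Finsupp.lhom_ext' (fun p => LinearMap.ext_ring (h p))

theorem mul_assoc_aux (x y z : PathAlgebra K V) : x * y * z = x * (y * z) := by
  let L : PathAlgebra K V →ₗ[K] PathAlgebra K V →ₗ[K] PathAlgebra K V →ₗ[K] PathAlgebra K V :=
    (mulLin (K := K) (V := V)).compr₂ mulLin
  let R : PathAlgebra K V →ₗ[K] PathAlgebra K V →ₗ[K] PathAlgebra K V →ₗ[K] PathAlgebra K V :=
    LinearMap.mk₂ K (fun x y => mulLin x ∘ₗ mulLin y)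
      (fun a b c => by ext; simp) (fun a b c => by ext; simp)
      (fun a b c => by ext; simp) (fun a b c => by ext; simp)
  have hLR : L = R := by
    refine lin_ext fun p => lin_ext fun q => lin_ext fun r => ?_
    change ofPath p * ofPath q * ofPath r = ofPath p * (ofPath q * ofPath r)
    obtain ⟨a, b, p⟩ := p
    obtain ⟨c, d, q⟩ := q
    obtain ⟨e, f, r⟩ := r
    have h0 : ∀ w : PathAlgebra K V, w * 0 = 0 := fun w => map_zero (mulLin w)
    have h1 : ∀ w : PathAlgebra K V, 0 * w = 0 := fun w => LinearMap.map_zero₂ mulLin w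
    by_cases hbc : b = c
    · subst hbc
      by_cases hde : d = e
      · subst hde
        rw [ofPath_comp, ofPath_comp, ofPath_comp, ofPath_comp, Quiver.Path.comp_assoc]
      · rw [ofPath_comp, ofPath_mul_of_ne _ _ hde, ofPath_mul_of_ne _ _ hde, h0]
    · rw [ofPath_mul_of_ne _ _ hbc, h1]
      by_cases hde : d = e
      · subst hde
        rw [ofPath_comp, ofPath_mul_of_ne _ _ hbc]
      · rw [ofPath_mul_of_ne _ _ hde, h0]
  exact congrArg (fun T => T x y z) hLR

theorem one_mul_aux [Fintype V] (x : PathAlgebra K V) : 1 * x = x := by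
  have h : mulLin (1 : PathAlgebra K V) = LinearMap.id := by
    refine lin_ext fun p => ?_
    obtain ⟨a, b, p⟩ := p
    rw [one_def, map_sum, LinearMap.sum_apply, Finset.sum_eq_single a]
    · rw [← mul_def, vertex, ofPath_comp, Quiver.Path.nil_comp, LinearMap.id_apply]
    · intro v _ hv
      rw [← mul_def, vertex, ofPath_mul_of_ne _ _ hv]
    · simp
  rw [mul_def, h, LinearMap.id_apply]

theorem mul_one_aux [Fintype V] (x : PathAlgebra K V) : x * 1 = x := by
  have h : (mulLin (K := K) (V := V)).flip 1 = LinearMap.id := by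
    refine lin_ext fun p => ?_
    obtain ⟨a, b, p⟩ := p
    rw [LinearMap.flip_apply, one_def, map_sum, Finset.sum_eq_single b]
    · rw [← mul_def, vertex, ofPath_comp, Quiver.Path.comp_nil, LinearMap.id_apply]
    · intro v _ hv
      rw [← mul_def, vertex, ofPath_mul_of_ne _ _ hv.symm]
    · simp
  rw [mul_def, ← LinearMap.flip_apply, h, LinearMap.id_apply]

instance [Fintype V] : Ring (PathAlgebra K V) where
  __ : AddCommGroup (PathAlgebra K V) := inferInstance
  mul_assoc := mul_assoc_aux
  one_mul := one_mul_aux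
  mul_one := mul_one_aux
  left_distrib x y z := map_add (mulLin x) y z
  right_distrib x y z := LinearMap.map_add₂ mulLin x y z
  zero_mul x := LinearMap.map_zero₂ mulLin x
  mul_zero x := map_zero (mulLin x)

instance [Fintype V] : Algebra K (PathAlgebra K V) :=
  Algebra.ofModule (fun r x y => LinearMap.map_smul₂ mulLin r x y)
    (fun r x y => map_smul (mulLin x) r y)

/-- The two-sided ideal of the path algebra generated by the arrows. -/
def arrowIdeal (K : Type u) [Field K] (V : Type u) [Quiver.{u, u} V] [Fintype V] :
    Ideal (PathAlgebra K V) :=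
  (TwoSidedIdeal.span {x | ∃ (a b : V) (f : a ⟶ b), x = arrow f}).asIdeal

/-- An ideal `I` of the path algebra is admissible if `J ^ n ⊆ I ⊆ J ^ 2` for some `n ≥ 2`,
where `J` is the ideal generated by the arrows. -/
def IsAdmissible [Fintype V] (I : Ideal (PathAlgebra K V)) : Prop :=
  I ≤ arrowIdeal K V ^ 2 ∧ ∃ n : ℕ, 2 ≤ n ∧ arrowIdeal K V ^ n ≤ I

end PathAlgebra

/-! ### Subquivers and the homological heart

A full subquiver is identified with its set of vertices. -/

namespace FullSubquiver

variable {V : Type u} [Quiver.{u, u} V]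

/-- The vertices outside `L` that are reached by a path starting in `L`. -/
def plus (L : Set V) : Set V := {v | v ∉ L ∧ ∃ w ∈ L, Nonempty (Quiver.Path w v)}

/-- The vertices outside `L` from which a path leads into `L`. -/
def minus (L : Set V) : Set V := {v | v ∉ L ∧ ∃ w ∈ L, Nonempty (Quiver.Path v w)}

/-- The vertices outside `L` that no path connects, in either direction, with a vertex of `L`. -/
def zero (L : Set V) : Set V :=
  {v | v ∉ L ∧ ∀ w ∈ L, IsEmpty (Quiver.Path v w) ∧ IsEmpty (Quiver.Path w v)}

variable (V)

/-- The vertices that lie on a nontrivial oriented cycle. -/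
def cyclic : Set V := {v | ∃ (a : V) (p : Quiver.Path a a), 0 < p.length ∧ v ∈ p.vertices}

/-- The homological heart: the vertices on nontrivial cycles, together with all vertices on
paths that start and end at vertices on nontrivial cycles. -/
def heart : Set V :=
  cyclic V ∪ {y | ∃ a ∈ cyclic V, ∃ b ∈ cyclic V, ∃ p : Quiver.Path a b, y ∈ p.vertices}

/-- The length of the longest path all of whose vertices lie outside the homological heart
(and `0` if every vertex lies in the heart). For a finite quiver the lengths are bounded,
since there are no cycles outside the heart. -/
def outerLength : ℕ :=
  sSup {n | ∃ (a b : V) (p : Quiver.Path a b), p.length = n ∧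
    ∀ v ∈ p.vertices, v ∈ plus (heart V) ∪ minus (heart V) ∪ zero (heart V)}

end FullSubquiver

/-! ### Homological dimensions

Right modules over `R` are modules over `Rᵐᵒᵖ`. -/

/-- The category of right modules over a ring. -/
abbrev RightMod (R : Type u) [Ring R] := ModuleCat.{u} Rᵐᵒᵖ

/-- The projective dimension of a right module; the zero module gets dimension `0`. -/
def projDim {R : Type u} [Ring R] (M : RightMod R) : ℕ∞ := (projectiveDimension M).unbotD 0

/-- The (right) global dimension: the supremum of the projective dimensions of the modules. -/
def glDim (R : Type u) [Ring R] : ℕ∞ := ⨆ M : RightMod R, projDim M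

/-- The (right) finitistic dimension: the supremum of the projective dimensions of the finitely
generated modules of finite projective dimension. -/
def finDim (R : Type u) [Ring R] : ℕ∞ :=
  ⨆ (M : RightMod R) (_ : Module.Finite Rᵐᵒᵖ M) (_ : projDim M < ⊤), projDim M

/-! ### Minimal resolutions, syzygies and cosyzygies -/

/-- A submodule is superfluous if it has no proper supplement. -/
def IsSuperfluous {R M : Type*} [Ring R] [AddCommGroup M] [Module R M] (U : Submodule R M) : Prop :=
  ∀ W : Submodule R M, U ⊔ W = ⊤ → W = ⊤

/-- A submodule is essential if it meets every nonzero submodule. -/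
def IsEssentialSub {R M : Type*} [Ring R] [AddCommGroup M] [Module R M] (U : Submodule R M) :
    Prop :=
  ∀ W : Submodule R M, U ⊓ W = ⊥ → W = ⊥

section Resolutions

variable {S : Type u} [Ring S]

/-- A minimal projective resolution: every `Pₙ` is a projective cover of the `n`-th syzygy
`coker (Pₙ₊₁ ⟶ Pₙ)`, i.e. the image of `Pₙ₊₁ ⟶ Pₙ` is superfluous. -/
structure MinimalProjectiveResolution (M : ModuleCat.{u} S) extends ProjectiveResolution M where
  minimal : ∀ n, IsSuperfluous (LinearMap.range (complex.d (n + 1) n).hom)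

/-- A minimal injective coresolution: every `Iₙ` is an injective envelope of the `n`-th cosyzygy
`ker (Iₙ ⟶ Iₙ₊₁)`, i.e. the kernel of `Iₙ ⟶ Iₙ₊₁` is essential. -/
structure MinimalInjectiveResolution (N : ModuleCat.{u} S) extends InjectiveResolution N where
  minimal : ∀ n, IsEssentialSub (LinearMap.ker (cocomplex.d n (n + 1)).hom)

namespace MinimalProjectiveResolution

variable {M M' : ModuleCat.{u} S}

/-- The `n`-th syzygy: the cokernel of `Pₙ₊₁ ⟶ Pₙ`, which by exactness is the image of
`Pₙ ⟶ Pₙ₋₁` for `n ≥ 1`, and is `M` for `n = 0`. -/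
def syzygy (P : MinimalProjectiveResolution M) (n : ℕ) : ModuleCat.{u} S := P.complex.opcycles n

/-- A chain map between resolutions lies over a homomorphism of the resolved modules. -/
def IsLift (P : MinimalProjectiveResolution M) (P' : MinimalProjectiveResolution M')
    (f : M ⟶ M') (φ : P.complex ⟶ P'.complex) : Prop :=
  φ ≫ P'.π = P.π ≫ (ChainComplex.single₀ (ModuleCat.{u} S)).map f

/-- The homomorphism of syzygies induced by a chain map. -/
def syzygyMap {P : MinimalProjectiveResolution M} {P' : MinimalProjectiveResolution M'}
    (φ : P.complex ⟶ P'.complex) (n : ℕ) : P.syzygy n ⟶ P'.syzygy n :=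
  HomologicalComplex.opcyclesMap φ n

end MinimalProjectiveResolution

namespace MinimalInjectiveResolution

variable {N N' : ModuleCat.{u} S}

/-- The `n`-th cosyzygy: the kernel of `Iₙ ⟶ Iₙ₊₁`, which by exactness is the image of
`Iₙ₋₁ ⟶ Iₙ` for `n ≥ 1`, and is `N` for `n = 0`. -/
def cosyzygy (J : MinimalInjectiveResolution N) (n : ℕ) : ModuleCat.{u} S := J.cocomplex.cycles n

/-- A cochain map between coresolutions lies over a homomorphism of the coresolved modules. -/
def IsLift (J : MinimalInjectiveResolution N) (J' : MinimalInjectiveResolution N')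
    (g : N ⟶ N') (ψ : J.cocomplex ⟶ J'.cocomplex) : Prop :=
  J.ι ≫ ψ = (CochainComplex.single₀ (ModuleCat.{u} S)).map g ≫ J'.ι

/-- The homomorphism of cosyzygies induced by a cochain map. -/
def cosyzygyMap {J : MinimalInjectiveResolution N} {J' : MinimalInjectiveResolution N'}
    (ψ : J.cocomplex ⟶ J'.cocomplex) (n : ℕ) : J.cosyzygy n ⟶ J'.cosyzygy n :=
  HomologicalComplex.cyclesMap ψ n

end MinimalInjectiveResolution

end Resolutions

/-! ### Modules over `Λ = K Q / I` and over the algebra associated to a full subquiver -/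

section Bound

variable {K : Type u} [Field K] {V : Type u} [Quiver.{u, u} V] [Fintype V]
  (I : Ideal (PathAlgebra K V)) [I.IsTwoSided]

/-- The algebra `Λ = K Q / I`. -/
abbrev BoundAlgebra : Type u := PathAlgebra K V ⧸ I

/-- The idempotent of `Λ` at a vertex. -/
def vertexIdem (v : V) : BoundAlgebra I := Ideal.Quotient.mk I (PathAlgebra.vertex v)

open Classical in
/-- The idempotent `e'` of `Λ`: the sum of the vertices that are not in `L`. -/
def outerIdem (L : Set V) : BoundAlgebra I := ∑ v with v ∉ L, vertexIdem I v

/-- The two-sided ideal of `Λ` generated by `e'`. -/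
def outerIdeal (L : Set V) : Ideal (BoundAlgebra I) :=
  (TwoSidedIdeal.span {outerIdem I L}).asIdeal

instance (L : Set V) : (outerIdeal I L).IsTwoSided :=
  inferInstanceAs (TwoSidedIdeal.asIdeal _).IsTwoSided

/-- The algebra `Γ = Λ / ⟨e'⟩` associated to the full subquiver with vertex set `L`. -/
abbrev AssocAlgebra (L : Set V) : Type u := BoundAlgebra I ⧸ outerIdeal I L

/-- The right `Λ`-module `C` has support contained in `X`: `C v = 0` for each vertex `v ∉ X`. -/
def SupportedIn (X : Set V) (C : Type*) [AddCommGroup C] [Module (BoundAlgebra I)ᵐᵒᵖ C] : Prop :=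
  ∀ v ∉ X, ∀ c : C, MulOpposite.op (vertexIdem I v) • c = 0

/-- `C⁺`, the largest submodule of `C` with support contained in `L⁺`. -/
def plusSub (L : Set V) (C : Type*) [AddCommGroup C] [Module (BoundAlgebra I)ᵐᵒᵖ C] :
    Submodule (BoundAlgebra I)ᵐᵒᵖ C :=
  sSup {U | SupportedIn I (FullSubquiver.plus L) U}

/-- `C₋`, the smallest submodule of `C` such that `C / C₋` has support contained in `L⁻`. -/
def minusSub (L : Set V) (C : Type*) [AddCommGroup C] [Module (BoundAlgebra I)ᵐᵒᵖ C] :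
    Submodule (BoundAlgebra I)ᵐᵒᵖ C :=
  sInf {U | SupportedIn I (FullSubquiver.minus L) (C ⧸ U)}

section

variable {I}
variable {C D : Type*} [AddCommGroup C] [Module (BoundAlgebra I)ᵐᵒᵖ C]
  [AddCommGroup D] [Module (BoundAlgebra I)ᵐᵒᵖ D]

theorem supportedIn_plusSub (L : Set V) :
    SupportedIn I (FullSubquiver.plus L) (plusSub I L C) := by
  intro v hv c
  refine Subtype.ext ?_
  change MulOpposite.op (vertexIdem I v) • (c : C) = 0
  have hc : (c : C) ∈ sSup {U : Submodule (BoundAlgebra I)ᵐᵒᵖ C |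
      SupportedIn I (FullSubquiver.plus L) U} := c.2
  rw [sSup_eq_iSup'] at hc
  refine Submodule.iSup_induction _ (motive := fun x => MulOpposite.op (vertexIdem I v) • x = 0)
    hc (fun U x hx => ?_) (smul_zero _) (fun x y hx hy => by rw [smul_add, hx, hy, add_zero])
  exact congrArg Subtype.val (U.2 v hv ⟨x, hx⟩)

theorem supportedIn_minusSub (L : Set V) :
    SupportedIn I (FullSubquiver.minus L) (C ⧸ minusSub I L C) := by
  intro v hv c
  obtain ⟨x, rfl⟩ := Submodule.Quotient.mk_surjective _ c
  rw [← Submodule.Quotient.mk_smul, Submodule.Quotient.mk_eq_zero]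
  refine (Submodule.mem_sInf).2 fun U hU => ?_
  rw [← Submodule.Quotient.mk_eq_zero, Submodule.Quotient.mk_smul]
  exact hU v hv _

theorem plusSub_le_comap (L : Set V) (f : C →ₗ[(BoundAlgebra I)ᵐᵒᵖ] D) :
    plusSub I L C ≤ (plusSub I L D).comap f := by
  refine sSup_le fun U hU => ?_
  rw [← Submodule.map_le_iff_le_comap]
  refine le_sSup ?_
  rintro v hv ⟨_, x, hx, rfl⟩
  have h := hU v hv ⟨x, hx⟩
  have h' : MulOpposite.op (vertexIdem I v) • x = 0 := congrArg Subtype.val h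
  refine Subtype.ext ?_
  change MulOpposite.op (vertexIdem I v) • f x = 0
  rw [← map_smul, h', map_zero]

theorem minusSub_le_comap (L : Set V) (f : C →ₗ[(BoundAlgebra I)ᵐᵒᵖ] D) :
    minusSub I L C ≤ (minusSub I L D).comap f := by
  intro c hc
  refine (Submodule.mem_sInf).2 fun U hU => ?_
  refine (Submodule.mem_sInf).1 hc (U.comap f) ?_
  intro v hv x
  obtain ⟨x, rfl⟩ := Submodule.Quotient.mk_surjective _ x
  have h := hU v hv (Submodule.Quotient.mk (f x))
  rw [← Submodule.Quotient.mk_smul, Submodule.Quotient.mk_eq_zero] at h ⊢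
  rwa [Submodule.mem_comap, map_smul]

end

/-- The right `Λ`-module `C / C⁺`. -/
def plusQuot (L : Set V) (C : RightMod (BoundAlgebra I)) : RightMod (BoundAlgebra I) :=
  ModuleCat.of _ (C ⧸ plusSub I L C)

/-- The right `Λ`-module `C₋`. -/
def minusPart (L : Set V) (C : RightMod (BoundAlgebra I)) : RightMod (BoundAlgebra I) :=
  ModuleCat.of _ (minusSub I L C)

variable {I}

/-- The homomorphism `C / C⁺ ⟶ D / D⁺` induced by a homomorphism `C ⟶ D`. -/
def plusQuotMap (L : Set V) {C D : RightMod (BoundAlgebra I)} (f : C ⟶ D) :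
    plusQuot I L C ⟶ plusQuot I L D :=
  ModuleCat.ofHom (Submodule.mapQ _ _ f.hom (plusSub_le_comap L f.hom))

/-- The homomorphism `C₋ ⟶ D₋` obtained by restricting a homomorphism `C ⟶ D`. -/
def minusPartMap (L : Set V) {C D : RightMod (BoundAlgebra I)} (f : C ⟶ D) :
    minusPart I L C ⟶ minusPart I L D :=
  ModuleCat.ofHom (f.hom.restrict (minusSub_le_comap L f.hom))

variable (I)

/-- The right `Λ`-module `C` is annihilated by `⟨e'⟩`, i.e. it is a module over
`Γ = Λ / ⟨e'⟩`. -/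
def IsAssocModule (L : Set V) (C : RightMod (BoundAlgebra I)) : Prop :=
  ∀ x ∈ outerIdeal I L, ∀ c : C, MulOpposite.op x • c = 0

variable {I}

/-- The action of `Γ` on a right `Λ`-module annihilated by `⟨e'⟩`: the class of `x` acts
as `x` does. -/
def IsAssocModule.action {L : Set V} {C : RightMod (BoundAlgebra I)} (h : IsAssocModule I L C) :
    AssocAlgebra I L →+* (AddMonoid.End C)ᵐᵒᵖ :=
  Ideal.Quotient.lift (outerIdeal I L)
    ((RingHom.op (Module.toAddMonoidEnd (BoundAlgebra I)ᵐᵒᵖ C)).comp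
      (RingEquiv.opOp (BoundAlgebra I)).toRingHom)
    (fun x hx => MulOpposite.unop_injective (AddMonoidHom.ext (fun c => h x hx c)))

/-- The right `Γ`-module structure on a right `Λ`-module annihilated by `⟨e'⟩`. -/
@[reducible]
def IsAssocModule.module {L : Set V} {C : RightMod (BoundAlgebra I)} (h : IsAssocModule I L C) :
    Module (AssocAlgebra I L)ᵐᵒᵖ C :=
  Module.compHom C (R := AddMonoid.End C)
    ((RingEquiv.opOp (AddMonoid.End C)).symm.toRingHom.comp (RingHom.op h.action))

/-- A right `Λ`-module annihilated by `⟨e'⟩`, viewed as a right `Γ`-module. -/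
def toAssoc {L : Set V} (C : RightMod (BoundAlgebra I)) (h : IsAssocModule I L C) :
    RightMod (AssocAlgebra I L) :=
  letI := h.module
  ModuleCat.of (AssocAlgebra I L)ᵐᵒᵖ C

theorem toAssoc_smul {L : Set V} {C : RightMod (BoundAlgebra I)} (h : IsAssocModule I L C)
    (x : BoundAlgebra I) (c : C) :
    letI := h.module
    (MulOpposite.op (Ideal.Quotient.mk (outerIdeal I L) x) • c : C) = MulOpposite.op x • c :=
  rfl

/-- A homomorphism of right `Λ`-modules annihilated by `⟨e'⟩`, viewed as a homomorphism of right
`Γ`-modules. -/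
def toAssocMap {L : Set V} {C D : RightMod (BoundAlgebra I)} (hC : IsAssocModule I L C)
    (hD : IsAssocModule I L D) (f : C ⟶ D) : toAssoc C hC ⟶ toAssoc D hD :=
  letI := hC.module
  letI := hD.module
  ModuleCat.ofHom
    { toFun := fun c => f.hom c
      map_add' := fun c d => map_add f.hom c d
      map_smul' := fun r c => by
        obtain ⟨r, rfl⟩ := MulOpposite.op_surjective r
        obtain ⟨x, rfl⟩ := Ideal.Quotient.mk_surjective r
        exact map_smul f.hom (MulOpposite.op x) c }

end Bound

end

/-! The proof rests on two facts about supports and one about inflation from Γ to Λ.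

Call a set S of vertices successor-closed if every path starting in S ends in S. The projective
cover of a module supported in such an S is again supported in S, and so is its kernel. Dimension
shifting then reduces Ext from modules supported in S to modules supported off S to the case of Hom,
which is zero (`SupportedIn.subsingleton_ext`). The heart is convex, so H⁺ and the complement of H⁻
are both successor-closed. Hence C may be replaced by C/C⁺ in Ext(C, D) if D is supported off H⁺,
and D by D₋ if C is supported off H⁻.

Minimality pushes supports along arrows: the n-th term of a minimal projective resolution lives at
vertices where paths of length at least n end, and the n-th term of a minimal injective coresolution
lives where such paths start (`supportedIn_X` in both namespaces). A path outside the heart repeats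
no vertex and has length at most t. So a path of length t+1 meets H, the syzygy Ω^{t+1} lives on
successors of H, and its quotient by the part in H⁺ lives on H and is a Γ-module. The cosyzygy is
treated dually.

Inflation along Λ → Γ is exact and fully faithful. It induces isomorphisms on all Ext groups
(`mapExt_inflation_bijective`), because inflations of Γ-projectives are acyclic for inflated
modules: such a projective P is a direct summand of Q/Q⁺, where Q is its projective cover over Λ.

The comparison map pulls an inflated extension class back along Ω^{t+1}(M) → A_M, pushes it out
along B_N → Ω^{-t-1}(N), and takes Yoneda products with the classes of the two truncated resolutions
(`extComparison`). Each factor is bijective in positive degree, and each is natural. The statements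
on dimensions follow by letting vanishing of Ext travel along these bijections; finite generation of
A_M uses that Λ is noetherian. -/

noncomputable section

/-! ### Combinatorics of the homological heart -/

namespace FullSubquiver

variable {V : Type u} [Quiver.{u, u} V]

/-- The vertices that are reached by a path starting in `L`. -/
def reach (L : Set V) : Set V := {v | ∃ w ∈ L, Nonempty (Quiver.Path w v)}

/-- The vertices from which a path leads into `L`. -/
def coreach (L : Set V) : Set V := {v | ∃ w ∈ L, Nonempty (Quiver.Path v w)}

/-- A set of vertices that contains the terminus of each path starting in it. -/
def SuccClosed (S : Set V) : Prop := ∀ ⦃a b : V⦄, Quiver.Path a b → a ∈ S → b ∈ S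

theorem subset_reach (L : Set V) : L ⊆ reach L := fun v hv => ⟨v, hv, ⟨Quiver.Path.nil⟩⟩

theorem subset_coreach (L : Set V) : L ⊆ coreach L := fun v hv => ⟨v, hv, ⟨Quiver.Path.nil⟩⟩

theorem succClosed_reach (L : Set V) : SuccClosed (reach L) := by
  rintro a b p ⟨w, hw, ⟨q⟩⟩
  exact ⟨w, hw, ⟨q.comp p⟩⟩

theorem succClosed_compl_coreach (L : Set V) : SuccClosed (coreach L)ᶜ := by
  rintro a b p ha ⟨w, hw, ⟨q⟩⟩
  exact ha ⟨w, hw, ⟨p.comp q⟩⟩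

/-- A path between cyclic vertices splits at each vertex it visits; conversely a path from a cycle
to `v` and one from `v` to a cycle can be concatenated. This removes the union and the chosen path
from the definition. -/
theorem mem_heart_iff {v : V} :
    v ∈ heart V ↔ v ∈ reach (cyclic V) ∧ v ∈ coreach (cyclic V) := by
  constructor
  · rintro (h | ⟨a, ha, b, hb, p, hp⟩)
    · exact ⟨subset_reach _ h, subset_coreach _ h⟩
    · obtain ⟨p₁, p₂, -⟩ := p.exists_eq_comp_of_mem_vertices hp
      exact ⟨⟨a, ha, ⟨p₁⟩⟩, ⟨b, hb, ⟨p₂⟩⟩⟩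
  · rintro ⟨⟨a, ha, ⟨p⟩⟩, ⟨b, hb, ⟨q⟩⟩⟩
    exact Or.inr ⟨a, ha, b, hb, p.comp q, by
      rw [Quiver.Path.vertices_comp]
      exact List.mem_append_right _ q.start_mem_vertices⟩

/-- Convexity of the heart. It separates the vertices off the heart into those strictly after it,
those strictly before it, and the unrelated ones. -/
theorem reach_inter_coreach_heart : reach (heart V) ∩ coreach (heart V) = heart V := by
  refine Set.Subset.antisymm ?_ fun v hv => ⟨subset_reach _ hv, subset_coreach _ hv⟩
  rintro v ⟨⟨a, ha, ⟨p⟩⟩, ⟨b, hb, ⟨q⟩⟩⟩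
  rw [mem_heart_iff] at ha hb ⊢
  exact ⟨succClosed_reach _ p ha.1, by
    by_contra h
    exact succClosed_compl_coreach _ q h hb.2⟩

theorem plus_eq (L : Set V) : plus L = reach L \ L := Set.ext fun _ => and_comm

theorem minus_eq (L : Set V) : minus L = coreach L \ L := Set.ext fun _ => and_comm

theorem plus_heart : plus (heart V) = reach (heart V) ∩ (coreach (heart V))ᶜ := by
  rw [plus_eq]
  nth_rewrite 2 [← reach_inter_coreach_heart]
  rw [Set.sdiff_self_inter]
  rfl

theorem minus_heart : minus (heart V) = coreach (heart V) ∩ (reach (heart V))ᶜ := by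
  rw [minus_eq]
  nth_rewrite 2 [← reach_inter_coreach_heart]
  rw [Set.sdiff_inter_self_eq_sdiff]
  rfl

/-- By convexity H⁺ is an intersection of two successor-closed sets. For the complement of H⁻ below
it is a union of two. -/
theorem succClosed_plus_heart : SuccClosed (plus (heart V)) := by
  rw [plus_heart]
  exact fun a b p h => ⟨succClosed_reach _ p h.1, succClosed_compl_coreach _ p h.2⟩

theorem succClosed_compl_minus_heart : SuccClosed (minus (heart V))ᶜ := by
  rw [minus_heart, Set.compl_inter, compl_compl]
  exact fun a b p h => h.imp (succClosed_compl_coreach _ p) (succClosed_reach _ p)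

theorem plus_union_minus_union_zero (L : Set V) : plus L ∪ minus L ∪ zero L = Lᶜ := by
  ext v
  simp only [plus, minus, zero, Set.mem_union, Set.mem_ofPred_eq, Set.mem_compl_iff]
  constructor
  · rintro ((h | h) | h) <;> exact h.1
  · intro h
    by_cases h1 : ∃ w ∈ L, Nonempty (Quiver.Path w v)
    · exact Or.inl (Or.inl ⟨h, h1⟩)
    by_cases h2 : ∃ w ∈ L, Nonempty (Quiver.Path v w)
    · exact Or.inl (Or.inr ⟨h, h2⟩)
    push Not at h1 h2
    exact Or.inr ⟨h, fun w hw => ⟨h2 w hw, h1 w hw⟩⟩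

/-- If the last arrow returned to a vertex already visited, the part of the path from that vertex on
would be a nontrivial cycle. -/
theorem nodup_vertices {a b : V} (p : Quiver.Path a b) (hp : ∀ v ∈ p.vertices, v ∉ cyclic V) :
    p.vertices.Nodup := by
  induction p with
  | nil => simp
  | @cons c d p e ih =>
    rw [Quiver.Path.vertices_cons, List.concat_eq_append] at hp ⊢
    refine (ih fun v hv => hp v (List.mem_append_left _ hv)).append (List.nodup_singleton _) ?_
    rintro v hv hv'
    obtain rfl := List.mem_singleton.1 hv'
    obtain ⟨p₁, p₂, -⟩ := p.exists_eq_comp_of_mem_vertices hv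
    exact hp v (List.mem_append_left _ hv)
      ⟨v, p₂.cons e, Nat.succ_pos _, Quiver.Path.start_mem_vertices _⟩

theorem length_le_outerLength [Fintype V] {a b : V} (p : Quiver.Path a b)
    (hp : ∀ v ∈ p.vertices, v ∉ heart V) : p.length ≤ outerLength V := by
  rw [outerLength, plus_union_minus_union_zero]
  -- A supremum in ℕ bounds only a set that is bounded above; the bound here holds because the
  -- vertices of such a path are distinct.
  refine le_csSup ⟨Fintype.card V, ?_⟩ ⟨a, b, p, rfl, hp⟩
  rintro n ⟨a, b, p, rfl, hp⟩
  have h := (nodup_vertices p fun v hv hc => hp v hv (Or.inl hc)).length_le_card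
  rw [Quiver.Path.vertices_length] at h
  omega

/-- A path that ends outside the successors of the heart has length at most `outerLength`. -/
theorem length_le_of_notMem_reach [Fintype V] {a b : V} (p : Quiver.Path a b)
    (hb : b ∉ reach (heart V)) : p.length ≤ outerLength V := by
  refine length_le_outerLength p fun v hv hv' => hb ?_
  obtain ⟨-, p₂, -⟩ := p.exists_eq_comp_of_mem_vertices hv
  exact ⟨v, hv', ⟨p₂⟩⟩

/-- A path that starts outside the predecessors of the heart has length at most `outerLength`. -/
theorem length_le_of_notMem_coreach [Fintype V] {a b : V} (p : Quiver.Path a b)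
    (ha : a ∉ coreach (heart V)) : p.length ≤ outerLength V := by
  refine length_le_outerLength p fun v hv hv' => ha ?_
  obtain ⟨p₁, -⟩ := p.exists_eq_comp_of_mem_vertices hv
  exact ⟨v, hv', ⟨p₁⟩⟩

end FullSubquiver

/-! ### Modules over a bound path algebra and their supports -/

open MulOpposite FullSubquiver

section Bound

variable {K : Type u} [Field K] {V : Type u} [Quiver.{u, u} V] [Fintype V]
  (I : Ideal (PathAlgebra K V)) [I.IsTwoSided]

/-- The class of a path in `Λ`. -/
def pathElt {a b : V} (p : Quiver.Path a b) : BoundAlgebra I :=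
  Ideal.Quotient.mk I (PathAlgebra.ofPath ⟨a, b, p⟩)

theorem pathElt_nil (v : V) : pathElt I (Quiver.Path.nil : Quiver.Path v v) = vertexIdem I v := rfl

theorem pathElt_comp {a b c : V} (p : Quiver.Path a b) (q : Quiver.Path b c) :
    pathElt I (p.comp q) = pathElt I p * pathElt I q := by
  rw [pathElt, ← PathAlgebra.ofPath_comp, map_mul]
  rfl

theorem pathElt_mul_of_ne {a b c d : V} (p : Quiver.Path a b) (q : Quiver.Path c d) (h : b ≠ c) :
    pathElt I p * pathElt I q = 0 := by
  rw [pathElt, pathElt, ← map_mul, PathAlgebra.ofPath_mul_of_ne _ _ h, map_zero]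

theorem pathElt_mul_vertexIdem {a b : V} (p : Quiver.Path a b) :
    pathElt I p * vertexIdem I b = pathElt I p := by
  rw [← pathElt_nil, ← pathElt_comp, Quiver.Path.comp_nil]

theorem vertexIdem_mul_pathElt {a b : V} (p : Quiver.Path a b) :
    vertexIdem I a * pathElt I p = pathElt I p := by
  rw [← pathElt_nil, ← pathElt_comp, Quiver.Path.nil_comp]

theorem vertexIdem_mul_self (v : V) : vertexIdem I v * vertexIdem I v = vertexIdem I v :=
  pathElt_mul_vertexIdem I Quiver.Path.nil

theorem vertexIdem_mul_of_ne {v w : V} (h : v ≠ w) : vertexIdem I v * vertexIdem I w = 0 :=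
  pathElt_mul_of_ne I Quiver.Path.nil Quiver.Path.nil h

theorem sum_vertexIdem : ∑ v : V, vertexIdem I v = 1 := by
  rw [← map_one (Ideal.Quotient.mk I), PathAlgebra.one_def, map_sum]
  rfl

variable {I}

theorem BoundAlgebra.induction {P : BoundAlgebra I → Prop} (r : BoundAlgebra I)
    (zero : P 0) (add : ∀ x y, P x → P y → P (x + y))
    (path : ∀ (c : K) {a b : V} (p : Quiver.Path a b), P (c • pathElt I p)) : P r := by
  obtain ⟨x, rfl⟩ := Ideal.Quotient.mk_surjective r
  refine Finsupp.induction_linear (motive := fun x : QuiverPath V →₀ K =>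
    P (Ideal.Quotient.mk I (x : PathAlgebra K V))) x ?_ ?_ ?_
  · rwa [show ((0 : QuiverPath V →₀ K) : PathAlgebra K V) = (0 : PathAlgebra K V) from rfl,
      map_zero]
  · intro f g hf hg
    exact (map_add (Ideal.Quotient.mk I) (f : PathAlgebra K V) (g : PathAlgebra K V)) ▸
      add _ _ hf hg
  · rintro ⟨a, b, p⟩ c
    have h : (Finsupp.single (⟨a, b, p⟩ : QuiverPath V) c : QuiverPath V →₀ K) =
        c • (PathAlgebra.ofPath ⟨a, b, p⟩ : PathAlgebra K V) :=
      (Finsupp.smul_single_one _ _).symm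
    rw [h]
    exact path c p

/-- The corner of Λ cut out by the two idempotents is spanned by the classes of paths from `v` to
`w`. -/
theorem vertexIdem_mul_mul_vertexIdem {v w : V} (h : IsEmpty (Quiver.Path v w))
    (r : BoundAlgebra I) : vertexIdem I v * r * vertexIdem I w = 0 := by
  induction r using BoundAlgebra.induction with
  | zero => simp
  | add x y hx hy => rw [mul_add, add_mul, hx, hy, add_zero]
  | @path c a b p =>
    rw [mul_smul_comm, smul_mul_assoc]
    by_cases hv : v = a
    · by_cases hw : b = w
      · subst hv hw
        exact h.elim p
      · rw [mul_assoc, ← pathElt_nil, ← pathElt_nil, pathElt_mul_of_ne I p _ hw, mul_zero,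
          smul_zero]
    · rw [← pathElt_nil, ← pathElt_nil, pathElt_mul_of_ne I _ p hv, zero_mul, smul_zero]

section Module

variable {C D : Type*} [AddCommGroup C] [Module (BoundAlgebra I)ᵐᵒᵖ C]
  [AddCommGroup D] [Module (BoundAlgebra I)ᵐᵒᵖ D]

theorem op_smul_smul (r s : BoundAlgebra I) (c : C) : op s • op r • c = op (r * s) • c := by
  rw [smul_smul, ← MulOpposite.op_mul]

theorem op_algebra_smul (k : K) (r : BoundAlgebra I) (c : C) :
    op (k • r) • c = op r • op (algebraMap K (BoundAlgebra I) k) • c := by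
  rw [op_smul_smul, ← Algebra.smul_def]

variable (I) in
theorem sum_vertexIdem_smul (c : C) : ∑ v : V, op (vertexIdem I v) • c = c := by
  rw [← Finset.sum_smul, ← Finset.op_sum, sum_vertexIdem, MulOpposite.op_one, one_smul]

variable (I) in
theorem eq_zero_of_vertexIdem_smul {c : C} (h : ∀ v : V, op (vertexIdem I v) • c = 0) : c = 0 := by
  rw [← sum_vertexIdem_smul I c]
  exact Finset.sum_eq_zero fun v _ => h v

theorem SupportedIn.mono {X Y : Set V} (h : SupportedIn I X C) (hXY : X ⊆ Y) :
    SupportedIn I Y C := fun v hv => h v fun hv' => hv (hXY hv')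

theorem SupportedIn.inter {X Y : Set V} (h : SupportedIn I X C) (h' : SupportedIn I Y C) :
    SupportedIn I (X ∩ Y) C := by
  intro v hv
  by_cases hX : v ∈ X
  · exact h' v fun hY => hv ⟨hX, hY⟩
  · exact h v hX

theorem SupportedIn.of_injective {X : Set V} (f : C →ₗ[(BoundAlgebra I)ᵐᵒᵖ] D)
    (hf : Function.Injective f) (h : SupportedIn I X D) : SupportedIn I X C := by
  intro v hv c
  apply hf
  rw [map_smul, map_zero, h v hv]

theorem SupportedIn.of_surjective {X : Set V} (f : C →ₗ[(BoundAlgebra I)ᵐᵒᵖ] D)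
    (hf : Function.Surjective f) (h : SupportedIn I X C) : SupportedIn I X D := by
  intro v hv d
  obtain ⟨c, rfl⟩ := hf d
  rw [← map_smul, h v hv, map_zero]

theorem SupportedIn.linearMap_eq_zero {S : Set V} (hC : SupportedIn I S C)
    (hD : SupportedIn I Sᶜ D) (f : C →ₗ[(BoundAlgebra I)ᵐᵒᵖ] D) : f = 0 := by
  ext c
  refine eq_zero_of_vertexIdem_smul I fun v => ?_
  by_cases hv : v ∈ S
  · exact hD v (fun h => h hv) _
  · rw [← map_smul, hC v hv, map_zero]

variable (I C) in
/-- The submodule of the elements with support in a set of vertices closed under successors. -/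
def supportSub (S : Set V) (hS : SuccClosed S) : Submodule (BoundAlgebra I)ᵐᵒᵖ C where
  carrier := {c | ∀ v ∉ S, op (vertexIdem I v) • c = 0}
  zero_mem' := fun v _ => smul_zero _
  add_mem' := fun {x y} hx hy v hv => by rw [smul_add, hx v hv, hy v hv, add_zero]
  smul_mem' := fun r c hc v hv => by
    obtain ⟨r, rfl⟩ := op_surjective r
    -- Split `c` into its vertex components: those off `S` vanish, and those in `S` cannot be
    -- carried to `v` because no path leaves `S`.
    rw [← sum_vertexIdem_smul I c, Finset.smul_sum, Finset.smul_sum]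
    refine Finset.sum_eq_zero fun w _ => ?_
    by_cases hw : w ∈ S
    · rw [op_smul_smul, op_smul_smul, ← mul_assoc, vertexIdem_mul_mul_vertexIdem ⟨fun p => hv (hS p hw)⟩,
        MulOpposite.op_zero, zero_smul]
    · rw [hc w hw, smul_zero, smul_zero]

theorem vertexIdem_smul_mem_supportSub {S : Set V} (hS : SuccClosed S) {v : V} (hv : v ∈ S)
    (c : C) : op (vertexIdem I v) • c ∈ supportSub I C S hS := by
  intro w hw
  rw [op_smul_smul, vertexIdem_mul_of_ne I (fun h : v = w => hw (h ▸ hv)), MulOpposite.op_zero, zero_smul]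

theorem supportedIn_supportSub {S : Set V} (hS : SuccClosed S) :
    SupportedIn I S (supportSub I C S hS) :=
  fun v hv c => Subtype.ext (c.2 v hv)

theorem supportedIn_quotient_supportSub {S : Set V} (hS : SuccClosed S) :
    SupportedIn I Sᶜ (C ⧸ supportSub I C S hS) := by
  intro v hv c
  obtain ⟨x, rfl⟩ := Submodule.Quotient.mk_surjective _ c
  rw [← Submodule.Quotient.mk_smul, Submodule.Quotient.mk_eq_zero]
  exact vertexIdem_smul_mem_supportSub hS (not_not.1 hv) x

/-- The extremal definition becomes a condition on vertex components. This is what shows that the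
quotient has no support left in L⁺. -/
theorem plusSub_eq {L : Set V} (hL : SuccClosed (plus L)) :
    plusSub I L C = supportSub I C (plus L) hL := by
  refine le_antisymm (fun c hc v hv => ?_) (le_sSup (supportedIn_supportSub hL))
  exact congrArg Subtype.val (supportedIn_plusSub L v hv ⟨c, hc⟩)

theorem minusSub_eq {L : Set V} (hL : SuccClosed (minus L)ᶜ) :
    minusSub I L C = supportSub I C (minus L)ᶜ hL := by
  refine le_antisymm (sInf_le ?_) (fun c hc => ?_)
  · simpa using (supportedIn_quotient_supportSub (C := C) hL)
  -- A component of `c` at a vertex off L⁻ dies in the quotient by `minusSub`, since that quotient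
  -- is supported in L⁻; the components at L⁻ are zero by assumption.
  · rw [← sum_vertexIdem_smul I c]
    refine Submodule.sum_mem _ fun v _ => ?_
    by_cases hv : v ∈ minus L
    · rw [hc v (fun h => h hv)]
      exact zero_mem _
    · rw [← Submodule.Quotient.mk_eq_zero, Submodule.Quotient.mk_smul]
      exact supportedIn_minusSub L v hv _

theorem SupportedIn.outerIdeal_smul {L : Set V} (hC : SupportedIn I L C) {x : BoundAlgebra I}
    (hx : x ∈ outerIdeal I L) (c : C) : op x • c = 0 := by
  -- The annihilator of `C` is a two-sided ideal, so it is enough that it contains e'.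
  let T : TwoSidedIdeal (BoundAlgebra I) := TwoSidedIdeal.mk'
    {y | ∀ c : C, op y • c = 0} (fun c => by simp)
    (fun {x y} hx hy c => by rw [MulOpposite.op_add, add_smul, hx, hy, add_zero])
    (fun {x} hx c => by rw [MulOpposite.op_neg, neg_smul, hx, neg_zero])
    (fun {x y} hy c => by rw [MulOpposite.op_mul, mul_smul, hy])
    (fun {x y} hx c => by rw [MulOpposite.op_mul, mul_smul, hx, smul_zero])
  have hT : ∀ y, y ∈ T ↔ ∀ c : C, op y • c = 0 := fun y => TwoSidedIdeal.mem_mk' ..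
  refine (hT x).1 (TwoSidedIdeal.span_le.2 ?_ (TwoSidedIdeal.mem_asIdeal.1 hx)) c
  rintro y rfl
  refine (hT _).2 fun c => ?_
  rw [outerIdem, Finset.op_sum, Finset.sum_smul]
  exact Finset.sum_eq_zero fun v hv => hC v (by simpa using hv) c

theorem vertexIdem_mem_outerIdeal {L : Set V} {v : V} (hv : v ∉ L) :
    vertexIdem I v ∈ outerIdeal I L := by
  classical
  have h : vertexIdem I v = vertexIdem I v * outerIdem I L := by
    rw [outerIdem, Finset.mul_sum, Finset.sum_eq_single v]
    · rw [vertexIdem_mul_self]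
    · intro w _ hw
      rw [vertexIdem_mul_of_ne I hw.symm]
    · intro h
      exact absurd (by simpa using hv) h
  rw [h]
  exact Ideal.mul_mem_left _ _ (TwoSidedIdeal.mem_asIdeal.2 (TwoSidedIdeal.subset_span rfl))

/-- If no arrow `w ⟶ v` carries a nonzero element into `C v`, then the elements of `C v` arise
only from the trivial path. -/
theorem exists_smul_vertexIdem_smul (r : BoundAlgebra I) (v : V) :
    ∃ k : K, ∀ c : C, (∀ w, (w ⟶ v) → ∀ x : C, op (vertexIdem I w) • x = 0) →
      op (vertexIdem I v) • op r • c =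
        op (algebraMap K (BoundAlgebra I) k) • op (vertexIdem I v) • c := by
  induction r using BoundAlgebra.induction with
  | zero => exact ⟨0, fun c _ => by simp⟩
  | add x y hx hy =>
    obtain ⟨k, hk⟩ := hx
    obtain ⟨l, hl⟩ := hy
    exact ⟨k + l, fun c hc => by
      rw [MulOpposite.op_add, add_smul, smul_add, hk c hc, hl c hc, map_add, MulOpposite.op_add, add_smul]⟩
  | @path k a b p =>
    by_cases hb : b = v
    · subst hb
      cases p with
      | nil =>
        refine ⟨k, fun c _ => ?_⟩
        rw [pathElt_nil, op_smul_smul, op_smul_smul, smul_mul_assoc, vertexIdem_mul_self,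
          ← Algebra.commutes, Algebra.smul_def]
      | @cons w _ p f =>
        refine ⟨0, fun c hc => ?_⟩
        rw [map_zero, MulOpposite.op_zero, zero_smul, op_smul_smul, smul_mul_assoc, pathElt_mul_vertexIdem,
          op_algebra_smul, show p.cons f = p.comp f.toPath from rfl, pathElt_comp,
          ← vertexIdem_mul_pathElt I f.toPath, MulOpposite.op_mul, MulOpposite.op_mul, mul_smul, mul_smul, hc w f,
          smul_zero]
    · refine ⟨0, fun c _ => ?_⟩
      rw [map_zero, MulOpposite.op_zero, zero_smul, op_smul_smul, smul_mul_assoc, ← pathElt_nil,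
        pathElt_mul_of_ne I p _ hb, smul_zero, MulOpposite.op_zero, zero_smul]

/-- If the arrows starting at `v` annihilate an element `c` of `C v`, then `c` spans a submodule
of dimension at most one. -/
theorem exists_smul_of_vertexIdem_smul_eq (r : BoundAlgebra I) {v : V} {c : C}
    (hv : op (vertexIdem I v) • c = c)
    (hc : ∀ w, (v ⟶ w) → ∀ x : C, op (vertexIdem I w) • x = 0) :
    ∃ k : K, op r • c = op (algebraMap K (BoundAlgebra I) k) • c := by
  induction r using BoundAlgebra.induction with
  | zero => exact ⟨0, by simp⟩
  | add x y hx hy =>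
    obtain ⟨k, hk⟩ := hx
    obtain ⟨l, hl⟩ := hy
    exact ⟨k + l, by rw [MulOpposite.op_add, add_smul, hk, hl, map_add, MulOpposite.op_add, add_smul]⟩
  | @path k a b p =>
    -- A nontrivial path acts through its first arrow, whose target is a vertex where `C` vanishes.
    have key : ∀ {b : V} (p : Quiver.Path v b), 0 < p.length → op (pathElt I p) • c = 0 := by
      intro b p hp
      induction p with
      | nil => exact absurd hp (lt_irrefl 0)
      | @cons w b p f ih =>
        rw [show p.cons f = p.comp f.toPath from rfl, pathElt_comp, MulOpposite.op_mul, mul_smul]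
        cases p with
        | nil =>
          rw [pathElt_nil, hv, ← pathElt_mul_vertexIdem, MulOpposite.op_mul, mul_smul]
          exact hc _ f _
        | cons p g => rw [ih (Nat.succ_pos _), smul_zero]
    by_cases ha : v = a
    · subst ha
      rcases Nat.eq_zero_or_pos p.length with h | h
      · cases p with
        | nil =>
          refine ⟨k, ?_⟩
          nth_rewrite 2 [← hv]
          rw [op_smul_smul, pathElt_nil, ← Algebra.commutes, Algebra.smul_def]
        | cons p f => exact absurd h (Nat.succ_ne_zero _)
      · refine ⟨0, ?_⟩
        rw [map_zero, MulOpposite.op_zero, zero_smul, Algebra.smul_def, Algebra.commutes,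
          ← op_smul_smul, key p h, smul_zero]
    · refine ⟨0, ?_⟩
      rw [map_zero, MulOpposite.op_zero, zero_smul, ← hv, op_smul_smul, mul_smul_comm,
        ← pathElt_nil, pathElt_mul_of_ne I _ p ha, smul_zero, MulOpposite.op_zero, zero_smul]

end Module

end Bound

/-! ### The radical filtration and projective covers -/

section Bound

variable {K : Type u} [Field K] {V : Type u} [Quiver.{u, u} V] [Fintype V]
  {I : Ideal (PathAlgebra K V)} [I.IsTwoSided]

section Module

variable {C D : Type*} [AddCommGroup C] [Module (BoundAlgebra I)ᵐᵒᵖ C]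
  [AddCommGroup D] [Module (BoundAlgebra I)ᵐᵒᵖ D]

variable (I C) in
/-- The submodule `C Jᵏ` generated by the multiples of the paths of length at least `k`. -/
def radPow (k : ℕ) : Submodule (BoundAlgebra I)ᵐᵒᵖ C where
  __ := AddSubgroup.closure {x : C | ∃ (a b : V) (p : Quiver.Path a b) (c : C),
    k ≤ p.length ∧ op (pathElt I p) • c = x}
  -- The additive closure is already stable under Λ: prolonging a path does not shorten it, and
  -- scalars from `K` are absorbed into `c`.
  smul_mem' r x hx := by
    obtain ⟨r, rfl⟩ := op_surjective r
    refine AddSubgroup.closure_induction (p := fun x _ => op r • x ∈ AddSubgroup.closure _)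
      ?_ ?_ ?_ ?_ hx
    · rintro _ ⟨a, b, p, c, hp, rfl⟩
      induction r using BoundAlgebra.induction with
      | zero => simp
      | add x y hx hy =>
        rw [MulOpposite.op_add, add_smul]
        exact add_mem hx hy
      | @path l a' b' q =>
        rw [op_smul_smul, mul_smul_comm]
        by_cases h : b = a'
        · subst h
          rw [← pathElt_comp, op_algebra_smul]
          exact AddSubgroup.subset_closure ⟨a, b', p.comp q, _, by
            rw [Quiver.Path.length_comp]; omega, rfl⟩
        · rw [pathElt_mul_of_ne I p q h, smul_zero, MulOpposite.op_zero, zero_smul]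
          exact zero_mem _
    · simp
    · intro x y _ _ hx hy
      rw [smul_add]
      exact add_mem hx hy
    · intro x _ hx
      rw [smul_neg]
      exact neg_mem hx

theorem pathElt_smul_mem_radPow {k : ℕ} {a b : V} (p : Quiver.Path a b) (hp : k ≤ p.length)
    (c : C) : op (pathElt I p) • c ∈ radPow I C k :=
  AddSubgroup.subset_closure ⟨a, b, p, c, hp, rfl⟩

theorem radPow_induction {k : ℕ} {Q : C → Prop}
    (path : ∀ (a b : V) (p : Quiver.Path a b) (c : C), k ≤ p.length → Q (op (pathElt I p) • c))
    (zero : Q 0) (add : ∀ x y, Q x → Q y → Q (x + y)) (neg : ∀ x, Q x → Q (-x)) {x : C}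
    (hx : x ∈ radPow I C k) : Q x := by
  refine AddSubgroup.closure_induction (p := fun x _ => Q x) ?_ zero
    (fun x y _ _ => add x y) (fun x _ => neg x) hx
  rintro _ ⟨a, b, p, c, hp, rfl⟩
  exact path a b p c hp

theorem map_mem_radPow (f : C →ₗ[(BoundAlgebra I)ᵐᵒᵖ] D) {k : ℕ} {x : C}
    (hx : x ∈ radPow I C k) : f x ∈ radPow I D k := by
  refine radPow_induction (Q := fun x => f x ∈ radPow I D k) ?_ ?_ ?_ ?_ hx
  · intro a b p c hp
    rw [map_smul]
    exact pathElt_smul_mem_radPow p hp _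
  · rw [map_zero]
    exact zero_mem _
  · intro x y hx hy
    rw [map_add]
    exact add_mem hx hy
  · intro x hx
    rw [map_neg]
    exact neg_mem hx

/-- This is (CJ)Jᵏ ⊆ CJᵏ⁺¹ on generators, the step that drives the Nakayama argument. -/
theorem pathElt_smul_mem_radPow_succ {k : ℕ} {a b : V} (p : Quiver.Path a b) (hp : k ≤ p.length)
    {c : C} (hc : c ∈ radPow I C 1) : op (pathElt I p) • c ∈ radPow I C (k + 1) := by
  refine radPow_induction (Q := fun c => op (pathElt I p) • c ∈ radPow I C (k + 1))
    ?_ ?_ ?_ ?_ hc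
  · intro a' b' q c hq
    rw [op_smul_smul]
    by_cases h : b' = a
    · subst h
      rw [← pathElt_comp]
      exact pathElt_smul_mem_radPow _ (by rw [Quiver.Path.length_comp]; omega) _
    · rw [pathElt_mul_of_ne I q p h, MulOpposite.op_zero, zero_smul]
      exact zero_mem _
  · rw [smul_zero]
    exact zero_mem _
  · intro x y hx hy
    rw [smul_add]
    exact add_mem hx hy
  · intro x hx
    rw [smul_neg]
    exact neg_mem hx

theorem PathAlgebra.ofPath_mem_arrowIdeal_pow {a b : V} (p : Quiver.Path a b) :
    (ofPath ⟨a, b, p⟩ : PathAlgebra K V) ∈ arrowIdeal K V ^ p.length := by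
  induction p with
  | nil => simp [Submodule.pow_zero]
  | cons p f ih =>
    rw [show p.cons f = p.comp f.toPath from rfl, ← ofPath_comp, Quiver.Path.length_comp,
      show f.toPath.length = 1 from rfl, Submodule.pow_succ]
    exact Ideal.mul_mem_mul ih (TwoSidedIdeal.mem_asIdeal.2 (TwoSidedIdeal.subset_span
      ⟨_, _, f, rfl⟩))

theorem pathElt_eq_zero {n : ℕ} (hn : PathAlgebra.arrowIdeal K V ^ n ≤ I) {a b : V}
    (p : Quiver.Path a b) (hp : n ≤ p.length) : pathElt I p = 0 := by
  obtain ⟨v, p₁, p₂, rfl, rfl⟩ := p.exists_eq_comp_of_le_length hp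
  rw [pathElt_comp, pathElt, Ideal.Quotient.eq_zero_iff_mem.2
    (hn (PathAlgebra.ofPath_mem_arrowIdeal_pow p₁)), zero_mul]

theorem radPow_eq_bot {n : ℕ} (hn : PathAlgebra.arrowIdeal K V ^ n ≤ I) : radPow I C n = ⊥ := by
  refine (Submodule.eq_bot_iff _).2 fun x hx => ?_
  refine radPow_induction (Q := fun x : C => x = 0) ?_ rfl ?_ ?_ hx
  · intro a b p c hp
    rw [pathElt_eq_zero hn p hp, MulOpposite.op_zero, zero_smul]
  · rintro x y rfl rfl
    exact add_zero 0
  · rintro x rfl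
    exact neg_zero

theorem radPow_zero : radPow I C 0 = ⊤ := by
  have h : ∀ (x : C) (v : V), op (vertexIdem I v) • x ∈ radPow I C 0 := fun x v =>
    pathElt_smul_mem_radPow (Quiver.Path.nil (a := v)) (Nat.zero_le _) x
  rw [eq_top_iff]
  intro x _
  have hx := sum_vertexIdem_smul I x
  rw [← hx]
  exact sum_mem fun v _ => h x v

/-- Nakayama's lemma for a nilpotent ideal: substituting W + CJ = C into itself gives W + CJᵏ = C
for every k, and CJⁿ = 0. No finiteness of `C` is required. -/
theorem isSuperfluous_radPow_one {n : ℕ} (hn : PathAlgebra.arrowIdeal K V ^ n ≤ I) :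
    IsSuperfluous (radPow I C 1) := by
  intro W hW
  have key : ∀ k, W ⊔ radPow I C k = ⊤ := by
    intro k
    induction k with
    | zero => rw [radPow_zero, sup_top_eq]
    | succ k ih =>
      rw [eq_top_iff, ← ih]
      refine sup_le le_sup_left fun x hx => ?_
      refine radPow_induction (Q := fun x => x ∈ W ⊔ radPow I C (k + 1)) ?_ (zero_mem _)
        (fun x y => add_mem) (fun x => neg_mem) hx
      intro a b p c hp
      obtain ⟨y, hy, z, hz, rfl⟩ := Submodule.mem_sup.1 (hW ▸ Submodule.mem_top : c ∈ _)
      rw [smul_add]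
      exact add_mem (Submodule.mem_sup_right (pathElt_smul_mem_radPow_succ p hp hy))
        (Submodule.mem_sup_left (W.smul_mem _ hz))
  rw [← key n, radPow_eq_bot hn, sup_bot_eq]

theorem IsSuperfluous.mono {R M : Type*} [Ring R] [AddCommGroup M] [Module R M]
    {U U' : Submodule R M} (h : IsSuperfluous U) (hU : U' ≤ U) : IsSuperfluous U' :=
  fun W hW => h W (eq_top_iff.2 (hW ▸ sup_le_sup_right hU W))

/-- Modulo the arrows an element of Λ is a combination of vertices. The coefficients are chosen
before the module, so that `exists_projectiveCover` can use the same ones in `M` and in the regular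
module. -/
theorem exists_sub_sum_mem_radPow_one (r : BoundAlgebra I) :
    ∃ k : V → K, ∀ (C : Type u) [AddCommGroup C] [Module (BoundAlgebra I)ᵐᵒᵖ C] (c : C),
      op r • c - ∑ v, op (algebraMap K (BoundAlgebra I) (k v)) • op (vertexIdem I v) • c ∈
        radPow I C 1 := by
  classical
  induction r using BoundAlgebra.induction with
  | zero => exact ⟨0, fun C _ _ c => by simp⟩
  | add x y hx hy =>
    obtain ⟨k, hk⟩ := hx
    obtain ⟨l, hl⟩ := hy
    refine ⟨k + l, fun C _ _ c => ?_⟩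
    have h := add_mem (hk C c) (hl C c)
    rw [sub_add_sub_comm, ← Finset.sum_add_distrib] at h
    simpa only [Pi.add_apply, map_add, MulOpposite.op_add, add_smul] using h
  | @path k a b p =>
    rcases Nat.eq_zero_or_pos p.length with h | h
    · cases p with
      | nil =>
        refine ⟨Pi.single a k, fun C _ _ c => ?_⟩
        rw [Finset.sum_eq_single a]
        · rw [Pi.single_eq_same, op_smul_smul, ← Algebra.commutes, ← Algebra.smul_def,
            pathElt_nil, sub_self]
          exact zero_mem _
        · intro b _ hb
          rw [Pi.single_eq_of_ne hb, map_zero, MulOpposite.op_zero, zero_smul]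
        · simp
      | cons p f => exact absurd h (Nat.succ_ne_zero _)
    · refine ⟨0, fun C _ _ c => ?_⟩
      simp only [Pi.zero_apply, map_zero, MulOpposite.op_zero, zero_smul, Finset.sum_const_zero,
        sub_zero]
      rw [op_algebra_smul]
      exact pathElt_smul_mem_radPow p h _

end Module

open Finsupp in
/-- Every module over a bound path algebra has a projective cover. -/
theorem exists_projectiveCover {n : ℕ} (hn : PathAlgebra.arrowIdeal K V ^ n ≤ I)
    (M : Type u) [AddCommGroup M] [Module (BoundAlgebra I)ᵐᵒᵖ M] :
    ∃ (P : Type u) (_ : AddCommGroup P) (_ : Module (BoundAlgebra I)ᵐᵒᵖ P)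
      (f : P →ₗ[(BoundAlgebra I)ᵐᵒᵖ] M), Module.Projective (BoundAlgebra I)ᵐᵒᵖ P ∧
        Function.Surjective f ∧ IsSuperfluous (LinearMap.ker f) := by
  classical
  let : Module K M := Module.compHom M (algebraMap K (BoundAlgebra I)ᵐᵒᵖ)
  have : IsScalarTower K (BoundAlgebra I)ᵐᵒᵖ M := IsScalarTower.of_algebraMap_smul fun _ _ => rfl
  have hsmul : ∀ (k : K) (m : M), op (algebraMap K (BoundAlgebra I) k) • m = k • m :=
    fun _ _ => rfl
  let T := M ⧸ radPow I M 1
  -- Classes of elements concentrated at one vertex span M/MJ over `K`, so a basis can be chosen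
  -- among them; its lifts `m i` determine the summands of the cover.
  let s : Set T := {x | ∃ (v : V) (m : M), op (vertexIdem I v) • m = m ∧
    Submodule.Quotient.mk m = x}
  have hs : ⊤ ≤ Submodule.span K s := by
    rintro x -
    obtain ⟨m, rfl⟩ := Submodule.Quotient.mk_surjective _ x
    rw [← sum_vertexIdem_smul I m, ← Submodule.mkQ_apply, map_sum]
    refine Submodule.sum_mem _ fun v _ => Submodule.subset_span ⟨v, _, ?_, rfl⟩
    rw [op_smul_smul, vertexIdem_mul_self]
  obtain ⟨ι, b, hb⟩ : ∃ (ι : Type u) (b : Module.Basis ι K T), ∀ i, b i ∈ s :=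
    ⟨_, Module.Basis.ofSpan hs, fun i => Module.Basis.ofSpan_subset hs ⟨i, rfl⟩⟩
  choose v m hm hmb using hb
  let F := ι →₀ (BoundAlgebra I)ᵐᵒᵖ
  -- An idempotent endomorphism of the free module, with image the direct sum of the modules e_{v
  -- i}Λ. That image is the cover.
  let π : F →ₗ[(BoundAlgebra I)ᵐᵒᵖ] F :=
    linearCombination _ (fun i => single i (op (vertexIdem I (v i))))
  let g : F →ₗ[(BoundAlgebra I)ᵐᵒᵖ] M := linearCombination _ m
  have hπ1 : ∀ i r, π (single i (op r)) = single i (op (vertexIdem I (v i) * r)) := by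
    intro i r
    rw [linearCombination_single, smul_single, smul_eq_mul, MulOpposite.op_mul]
  have hπ2 : ∀ x i, π x i = x i * op (vertexIdem I (v i)) := by
    intro x i
    induction x using Finsupp.induction_linear with
    | zero =>
      rw [map_zero]
      exact (zero_mul _).symm
    | add x y hx hy => rw [map_add, Finsupp.add_apply, Finsupp.add_apply, hx, hy, add_mul]
    | single j r =>
      rw [linearCombination_single, smul_single, smul_eq_mul, single_apply, single_apply]
      split_ifs with h
      · rw [h]
      · rw [zero_mul]
  have hππ : π ∘ₗ π = π := by
    refine lhom_ext' fun i => LinearMap.ext_ring ?_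
    change π (π (single i (op 1))) = π (single i (op 1))
    rw [hπ1, hπ1, ← mul_assoc, vertexIdem_mul_self]
  have hgπ : g ∘ₗ π = g := by
    refine lhom_ext' fun i => LinearMap.ext_ring ?_
    change g (π (single i (op 1))) = g (single i (op 1))
    rw [hπ1, linearCombination_single, linearCombination_single, mul_one, hm,
      MulOpposite.op_one, one_smul]
  let P := LinearMap.range π
  have hP : ∀ p : P, π p = p := by
    rintro ⟨_, x, rfl⟩
    exact LinearMap.congr_fun hππ x
  refine ⟨P, inferInstance, inferInstance, g ∘ₗ P.subtype, ?_, ?_, ?_⟩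
  · refine Module.Projective.of_split P.subtype π.rangeRestrict ?_
    ext p : 2
    exact hP p
  · have hg : Function.Surjective g := by
      rw [← LinearMap.range_eq_top]
      -- The range of `g` contains lifts of a basis of M/MJ, so together with the superfluous
      -- submodule MJ it is everything.
      refine isSuperfluous_radPow_one hn _ ?_
      rw [← Submodule.comap_map_mkQ, eq_top_iff]
      intro x _
      have h1 : (⊤ : Submodule K T) ≤
          ((LinearMap.range g).map (radPow I M 1).mkQ).restrictScalars K := by
        rw [← b.span_eq, Submodule.span_le]
        rintro _ ⟨i, rfl⟩
        refine ⟨m i, ⟨single i 1, ?_⟩, hmb i⟩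
        rw [linearCombination_single, one_smul]
      exact h1 (Submodule.mem_top : (radPow I M 1).mkQ x ∈ ⊤)
    intro x
    obtain ⟨y, rfl⟩ := hg x
    exact ⟨⟨π y, y, rfl⟩, LinearMap.congr_fun hgπ y⟩
  · refine (isSuperfluous_radPow_one hn).mono ?_
    rintro p hp
    -- The kernel lies in PJ: modulo J the coordinates of `p` are scalars, and they give a linear
    -- relation between basis elements of M/MJ, hence vanish.
    choose k hk using fun i => exists_sub_sum_mem_radPow_one (unop (p.1 i))
    have hk1 : ∀ i, p.1 i • m i - k i (v i) • m i ∈ radPow I M 1 := by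
      intro i
      have h := hk i M (m i)
      rw [Finset.sum_eq_single (v i)] at h
      · rwa [hm, op_unop, hsmul] at h
      · intro w _ hw
        rw [← hm i, op_smul_smul (vertexIdem I (v i)), vertexIdem_mul_of_ne I hw.symm, MulOpposite.op_zero,
          zero_smul, smul_zero]
      · simp
    have hk2 : ∀ i ∈ p.1.support, k i (v i) = 0 := by
      refine linearIndependent_iff'.1 b.linearIndependent p.1.support (fun i => k i (v i)) ?_
      have h : (radPow I M 1).mkQ (g p.1) = 0 := by
        rw [show g p.1 = 0 from hp, map_zero]
      rw [linearCombination_apply, Finsupp.sum, map_sum] at h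
      rw [← h]
      refine Finset.sum_congr rfl fun i _ => ?_
      rw [← hmb, ← Submodule.Quotient.mk_smul]
      exact ((Submodule.Quotient.eq _).2 (hk1 i)).symm
    have hk3 : ∀ i ∈ p.1.support, p.1 i ∈ radPow I (BoundAlgebra I)ᵐᵒᵖ 1 := by
      intro i hi
      have h := hk i (BoundAlgebra I)ᵐᵒᵖ (op (vertexIdem I (v i)))
      rw [Finset.sum_eq_single (v i)] at h
      · rw [hk2 i hi, map_zero, MulOpposite.op_zero, zero_smul, sub_zero, op_unop] at h
        rwa [smul_eq_mul, ← hπ2, hP] at h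
      · intro w _ hw
        rw [smul_eq_mul (a := op (vertexIdem I w)), ← MulOpposite.op_mul,
          vertexIdem_mul_of_ne I hw.symm, MulOpposite.op_zero, smul_zero]
      · simp
    -- So far `p` lies in the radical of the free module `F`; the retraction onto `P` carries that
    -- radical into the radical of `P`.
    have hp' : p = π.rangeRestrict p.1 := Subtype.ext (hP p).symm
    rw [hp']
    refine map_mem_radPow _ ?_
    rw [← Finsupp.sum_single p.1]
    exact Submodule.sum_mem _ fun i hi =>
      map_mem_radPow (lsingle (R := (BoundAlgebra I)ᵐᵒᵖ) i) (hk3 i hi)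

end Bound

/-! ### Injective envelopes and minimal resolutions -/

theorem exists_maximal_disjoint {R M : Type*} [Ring R] [AddCommGroup M] [Module R M]
    {A B : Submodule R M} (h : Disjoint A B) :
    ∃ A' : Submodule R M, A ≤ A' ∧ Disjoint A' B ∧ ∀ X, A' ≤ X → Disjoint X B → X = A' := by
  obtain ⟨A', hA, hm⟩ := zorn_le_nonempty₀ {X : Submodule R M | Disjoint X B}
    (fun c hc hchain y hy => ⟨sSup c, (DirectedOn.disjoint_sSup_left hchain.directedOn).2 hc,
      fun z hz => le_sSup hz⟩) A h
  exact ⟨A', hA, hm.1, fun X hX hd => le_antisymm (hm.2 hd hX) hX⟩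

section Ring

variable {S : Type u} [Ring S]

/-- Every module has an injective envelope. -/
theorem exists_injectiveEnvelope (N : ModuleCat.{u} S) :
    ∃ (E : ModuleCat.{u} S) (i : N ⟶ E), Injective E ∧ Mono i ∧
      IsEssentialSub (LinearMap.range i.hom) := by
  obtain ⟨⟨E, hE, j, hj⟩⟩ := EnoughInjectives.presentation N
  let N₀ := LinearMap.range j.hom
  -- The envelope is `U`, a maximal submodule containing `N₀` and disjoint from a maximal complement
  -- `W` of `N₀`. Maximality of `W` makes `N₀` essential in `U`; maximality of `U` will make it a
  -- retract of the injective `E`.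
  obtain ⟨W, -, hW, hWm⟩ := exists_maximal_disjoint (disjoint_bot_left : Disjoint ⊥ N₀)
  obtain ⟨U, hNU, hU, hUm⟩ := exists_maximal_disjoint hW.symm
  have hess : ∀ X ≤ U, Disjoint X N₀ → X = ⊥ := by
    intro X hX hd
    have h1 : X ⊔ W = W := by
      refine hWm _ le_sup_right ?_
      rw [Submodule.disjoint_def]
      intro n hn hn'
      obtain ⟨x, hx, w, hw, rfl⟩ := Submodule.mem_sup.1 hn
      have hw0 : w = 0 := by
        refine Submodule.disjoint_def.1 hU w ?_ hw
        have := U.sub_mem (hNU hn') (hX hx)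
        rwa [add_sub_cancel_left] at this
      rw [hw0, add_zero] at hn' ⊢
      exact Submodule.disjoint_def.1 hd x hx hn'
    have h2 : X ≤ W := by
      rw [← h1]
      exact le_sup_left
    exact disjoint_self.1 (hU.mono hX h2)
  let q : U →ₗ[S] E ⧸ W := W.mkQ ∘ₗ U.subtype
  have hq : Function.Injective q := by
    rw [← LinearMap.ker_eq_bot, LinearMap.ker_eq_bot']
    intro x hx
    have hxW : (x : E) ∈ W := (Submodule.Quotient.mk_eq_zero W).1 hx
    exact Subtype.ext (Submodule.disjoint_def.1 hU x x.2 hxW)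
  have : Mono (ModuleCat.ofHom q) := (ModuleCat.mono_iff_injective _).2 hq
  -- Injectivity of `E` extends the inclusion of `U` along its embedding into E/W.
  let h : ModuleCat.of S (E ⧸ W) ⟶ E :=
    Injective.factorThru (ModuleCat.ofHom U.subtype : ModuleCat.of S U ⟶ E) (ModuleCat.ofHom q)
  have hh : ∀ x : U, h.hom (W.mkQ x) = x := fun x => by
    have := Injective.comp_factorThru (ModuleCat.ofHom U.subtype : ModuleCat.of S U ⟶ E)
      (ModuleCat.ofHom q)
    exact congrArg (fun f => f.hom x) this
  have hrange : LinearMap.range h.hom = U := by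
    refine hUm _ (fun x hx => ⟨W.mkQ x, hh ⟨x, hx⟩⟩) ?_
    rw [Submodule.disjoint_def]
    rintro _ ⟨y, rfl⟩ hy
    obtain ⟨y, rfl⟩ := W.mkQ_surjective y
    -- The preimage of `W` contains `W` and is disjoint from `N₀`, where the map is the identity, so
    -- maximality applies. It follows that the range of `h` meets `W` only in zero, hence equals
    -- `U`.
    have hY : W.comap (h.hom ∘ₗ W.mkQ) = W := by
      refine hWm _ (fun w hw => ?_) ?_
      · change h.hom (W.mkQ w) ∈ W
        rw [W.mkQ_apply, (Submodule.Quotient.mk_eq_zero W).2 hw, map_zero]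
        exact zero_mem _
      · rw [Submodule.disjoint_def]
        intro n hn hn'
        refine Submodule.disjoint_def.1 hU n (hNU hn') ?_
        rwa [Submodule.mem_comap, LinearMap.comp_apply, hh ⟨n, hNU hn'⟩] at hn
    have hyW : y ∈ W := by
      rw [← hY]
      exact hy
    rw [W.mkQ_apply, (Submodule.Quotient.mk_eq_zero W).2 hyW, map_zero]
  have hjU : ∀ x, j.hom x ∈ U := fun x => hNU ⟨x, rfl⟩
  have hrU : ∀ x, (h.hom ∘ₗ W.mkQ) x ∈ U := fun x => hrange ▸ ⟨_, rfl⟩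
  refine ⟨ModuleCat.of S U, ModuleCat.ofHom (j.hom.codRestrict U hjU), ?_, ?_, ?_⟩
  · refine Retract.injective (Y := E) ⟨ModuleCat.ofHom U.subtype,
      ModuleCat.ofHom ((h.hom ∘ₗ W.mkQ).codRestrict U hrU), ?_⟩
    refine ModuleCat.hom_ext (LinearMap.ext fun x => Subtype.ext ?_)
    exact hh x
  · rw [ModuleCat.mono_iff_injective] at hj ⊢
    exact fun x y hxy => hj (congrArg Subtype.val hxy)
  · intro X hX
    have h1 := hess (X.map U.subtype) (Submodule.map_subtype_le _ _) ?_
    · exact Submodule.map_injective_of_injective U.injective_subtype (h1.trans (Submodule.map_bot _).symm)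
    · rw [Submodule.disjoint_def]
      rintro _ ⟨x, hx, rfl⟩ ⟨y, hy⟩
      have hx' : x ∈ (⊥ : Submodule S U) := by
        rw [← show _ = (⊥ : Submodule S U) from hX]
        exact ⟨⟨y, Subtype.ext hy⟩, hx⟩
      rw [(Submodule.mem_bot S).1 hx', map_zero]

/-! ### Assembling minimal resolutions from covers and envelopes -/

namespace MinimalProjectiveResolution

/-- A minimal projective resolution from a sequence of modules. -/
def ofExact {M : ModuleCat.{u} S} (X : ℕ → ModuleCat.{u} S) (d : ∀ n, X (n + 1) ⟶ X n)
    (ε : X 0 ⟶ M) (hX : ∀ n, Projective (X n)) (hε : Function.Surjective ε.hom)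
    (h0 : LinearMap.range (d 0).hom = LinearMap.ker ε.hom)
    (hd : ∀ n, LinearMap.range (d (n + 1)).hom = LinearMap.ker (d n).hom)
    (hmin : ∀ n, IsSuperfluous (LinearMap.range (d n).hom)) : MinimalProjectiveResolution M :=
  have sq : ∀ n, d (n + 1) ≫ d n = 0 := fun n => ModuleCat.hom_ext (LinearMap.ext fun x => by
    have h : (d (n + 1)).hom x ∈ LinearMap.range (d (n + 1)).hom := ⟨x, rfl⟩
    rw [hd] at h
    exact h)
  have hε0 : d 0 ≫ ε = 0 := ModuleCat.hom_ext (LinearMap.ext fun x => by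
    have h : (d 0).hom x ∈ LinearMap.range (d 0).hom := ⟨x, rfl⟩
    rw [h0] at h
    exact h)
  have hofd : ∀ n, (ChainComplex.of X d sq).d (n + 1) n = d n := fun n => ChainComplex.of_d ..
  { complex := ChainComplex.of X d sq
    projective := hX
    π := (ChainComplex.toSingle₀Equiv _ _).symm ⟨ε, by rw [hofd]; exact hε0⟩
    quasiIso := ⟨fun n => by
      cases n
      · rw [ChainComplex.quasiIsoAt₀_iff, ShortComplex.quasiIso_iff_of_zeros']
        · have h : (ShortComplex.mk (d 0) ε hε0).Exact :=
            (ShortComplex.moduleCat_exact_iff_ker_sub_range _).2 h0.ge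
          refine (ShortComplex.exact_and_epi_g_iff_of_iso ?_).2
            ⟨h, (ModuleCat.epi_iff_surjective _).2 hε⟩
          exact ShortComplex.isoMk (Iso.refl _) (Iso.refl _) (Iso.refl _)
            ((Category.id_comp _).trans ((hofd _).symm.trans (Category.comp_id _).symm))
            ((Category.id_comp _).trans (Category.comp_id _).symm)
        all_goals rfl
      · rename_i n
        rw [quasiIsoAt_iff_exactAt']
        · rw [HomologicalComplex.exactAt_iff' _ (n + 1 + 1) (n + 1) n (by simp) (by simp)]
          have h : (ShortComplex.mk (d (n + 1)) (d n) (sq n)).Exact :=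
            (ShortComplex.moduleCat_exact_iff_ker_sub_range _).2 (hd n).ge
          refine (ShortComplex.exact_iff_of_iso ?_).2 h
          exact ShortComplex.isoMk (Iso.refl _) (Iso.refl _) (Iso.refl _)
            ((Category.id_comp _).trans ((hofd _).symm.trans (Category.comp_id _).symm))
            ((Category.id_comp _).trans ((hofd _).symm.trans (Category.comp_id _).symm))
        · apply ChainComplex.exactAt_succ_single_obj⟩
    minimal := fun n => (congrArg (fun f : X (n + 1) ⟶ X n =>
      IsSuperfluous (LinearMap.range f.hom)) (hofd n)).mpr (hmin n) }

end MinimalProjectiveResolution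

namespace MinimalInjectiveResolution

/-- A minimal injective coresolution from a sequence of modules. -/
def ofExact {N : ModuleCat.{u} S} (X : ℕ → ModuleCat.{u} S) (d : ∀ n, X n ⟶ X (n + 1))
    (η : N ⟶ X 0) (hX : ∀ n, Injective (X n)) (hη : Function.Injective η.hom)
    (h0 : LinearMap.ker (d 0).hom = LinearMap.range η.hom)
    (hd : ∀ n, LinearMap.ker (d (n + 1)).hom = LinearMap.range (d n).hom)
    (hmin : ∀ n, IsEssentialSub (LinearMap.ker (d n).hom)) : MinimalInjectiveResolution N :=
  have sq : ∀ n, d n ≫ d (n + 1) = 0 := fun n => ModuleCat.hom_ext (LinearMap.ext fun x => by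
    have h : (d n).hom x ∈ LinearMap.range (d n).hom := ⟨x, rfl⟩
    rw [← hd] at h
    exact h)
  have hη0 : η ≫ d 0 = 0 := ModuleCat.hom_ext (LinearMap.ext fun x => by
    have h : η.hom x ∈ LinearMap.range η.hom := ⟨x, rfl⟩
    rw [← h0] at h
    exact h)
  have hofd : ∀ n, (CochainComplex.of X d sq).d n (n + 1) = d n := fun n =>
    CochainComplex.of_d ..
  { cocomplex := CochainComplex.of X d sq
    injective := hX
    ι := (CochainComplex.fromSingle₀Equiv _ _).symm ⟨η, by rw [hofd]; exact hη0⟩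
    quasiIso := ⟨fun n => by
      cases n
      · rw [CochainComplex.quasiIsoAt₀_iff, ShortComplex.quasiIso_iff_of_zeros]
        · have h : (ShortComplex.mk η (d 0) hη0).Exact :=
            (ShortComplex.moduleCat_exact_iff_ker_sub_range _).2 h0.le
          refine (ShortComplex.exact_and_mono_f_iff_of_iso ?_).2
            ⟨h, (ModuleCat.mono_iff_injective _).2 hη⟩
          exact ShortComplex.isoMk (Iso.refl _) (Iso.refl _) (Iso.refl _)
            ((Category.id_comp _).trans (Category.comp_id _).symm)
            ((Category.id_comp _).trans ((hofd _).symm.trans (Category.comp_id _).symm))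
        all_goals rfl
      · rename_i n
        rw [quasiIsoAt_iff_exactAt]
        · rw [HomologicalComplex.exactAt_iff' _ n (n + 1) (n + 1 + 1) (by simp) (by simp)]
          have h : (ShortComplex.mk (d n) (d (n + 1)) (sq n)).Exact :=
            (ShortComplex.moduleCat_exact_iff_ker_sub_range _).2 (hd n).le
          refine (ShortComplex.exact_iff_of_iso ?_).2 h
          exact ShortComplex.isoMk (Iso.refl _) (Iso.refl _) (Iso.refl _)
            ((Category.id_comp _).trans ((hofd _).symm.trans (Category.comp_id _).symm))
            ((Category.id_comp _).trans ((hofd _).symm.trans (Category.comp_id _).symm))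
        · apply CochainComplex.exactAt_succ_single_obj⟩
    minimal := fun n => (congrArg (fun f : X n ⟶ X (n + 1) =>
      IsEssentialSub (LinearMap.ker f.hom)) (hofd n)).mpr (hmin n) }

end MinimalInjectiveResolution

/-- An injective envelope of a module. -/
structure InjectiveEnvelope (N : ModuleCat.{u} S) where
  obj : ModuleCat.{u} S
  hom : N ⟶ obj
  injective : Injective obj
  hom_injective : Function.Injective hom.hom
  essential : IsEssentialSub (LinearMap.range hom.hom)

namespace InjectiveEnvelope

instance (N : ModuleCat.{u} S) : Nonempty (InjectiveEnvelope N) := by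
  obtain ⟨E, i, hE, hi, h⟩ := exists_injectiveEnvelope N
  exact ⟨⟨E, i, hE, (ModuleCat.mono_iff_injective _).1 hi, h⟩⟩

variable (env : ∀ N : ModuleCat.{u} S, InjectiveEnvelope N) (N : ModuleCat.{u} S)

/-- The iterated cosyzygies with respect to chosen injective envelopes. -/
def cosyz : ℕ → ModuleCat.{u} S
  | 0 => N
  | n + 1 => ModuleCat.of S
      ((env (cosyz n)).obj ⧸ LinearMap.range (env (cosyz n)).hom.hom)

/-- The differential of the coresolution built from chosen injective envelopes. -/
def diff (n : ℕ) : (env (cosyz env N n)).obj ⟶ (env (cosyz env N (n + 1))).obj :=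
  (ModuleCat.ofHom (LinearMap.range (env (cosyz env N n)).hom.hom).mkQ :
    _ ⟶ cosyz env N (n + 1)) ≫ (env (cosyz env N (n + 1))).hom

theorem diff_apply (n : ℕ) (x : (env (cosyz env N n)).obj) :
    (diff env N n).hom x = (env (cosyz env N (n + 1))).hom.hom
      (Submodule.Quotient.mk x : _ ⧸ LinearMap.range (env (cosyz env N n)).hom.hom) := rfl

theorem ker_diff (n : ℕ) :
    LinearMap.ker (diff env N n).hom = LinearMap.range (env (cosyz env N n)).hom.hom := by
  ext x
  rw [LinearMap.mem_ker, diff_apply, ← Submodule.Quotient.mk_eq_zero]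
  constructor
  · intro h
    exact (env (cosyz env N (n + 1))).hom_injective (h.trans (map_zero _).symm)
  · intro h
    rw [h]
    exact map_zero _

theorem range_diff (n : ℕ) :
    LinearMap.range (diff env N n).hom =
      LinearMap.range (env (cosyz env N (n + 1))).hom.hom := by
  ext x
  constructor
  · rintro ⟨y, rfl⟩
    exact ⟨_, (diff_apply env N n y).symm⟩
  · rintro ⟨y, rfl⟩
    obtain ⟨z, hz⟩ := Submodule.Quotient.mk_surjective _ y
    refine ⟨z, ?_⟩
    rw [diff_apply, hz]

/-- The minimal injective coresolution built from chosen injective envelopes. -/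
def minimalResolution : MinimalInjectiveResolution N :=
  .ofExact (fun n => (env (cosyz env N n)).obj) (diff env N) (env N).hom
    (fun _ => (env _).injective) (env N).hom_injective (ker_diff env N 0)
    (fun n => (ker_diff env N (n + 1)).trans (range_diff env N n).symm)
    (fun n => (ker_diff env N n).symm ▸ (env _).essential)

end InjectiveEnvelope

theorem nonempty_minimalInjectiveResolution (N : ModuleCat.{u} S) :
    Nonempty (MinimalInjectiveResolution N) :=
  ⟨InjectiveEnvelope.minimalResolution (fun _ => Classical.arbitrary _) N⟩

/-- A projective cover of a module. -/
structure ProjectiveCover (M : ModuleCat.{u} S) where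
  obj : ModuleCat.{u} S
  hom : obj ⟶ M
  projective : Projective obj
  surjective : Function.Surjective hom.hom
  superfluous : IsSuperfluous (LinearMap.ker hom.hom)

namespace ProjectiveCover

variable (cov : ∀ M : ModuleCat.{u} S, ProjectiveCover M) (M : ModuleCat.{u} S)

/-- The iterated syzygies with respect to chosen projective covers. -/
def syz : ℕ → ModuleCat.{u} S
  | 0 => M
  | n + 1 => ModuleCat.of S (LinearMap.ker (cov (syz n)).hom.hom)

/-- The differential of the resolution built from chosen projective covers. -/
def diff (n : ℕ) : (cov (syz cov M (n + 1))).obj ⟶ (cov (syz cov M n)).obj :=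
  (cov (syz cov M (n + 1))).hom ≫
    (ModuleCat.ofHom (LinearMap.ker (cov (syz cov M n)).hom.hom).subtype : syz cov M (n + 1) ⟶ _)

theorem diff_apply (n : ℕ) (x : (cov (syz cov M (n + 1))).obj) :
    (diff cov M n).hom x =
      ((cov (syz cov M (n + 1))).hom.hom x : LinearMap.ker (cov (syz cov M n)).hom.hom).1 := rfl

theorem range_diff (n : ℕ) :
    LinearMap.range (diff cov M n).hom = LinearMap.ker (cov (syz cov M n)).hom.hom := by
  ext x
  constructor
  · rintro ⟨y, rfl⟩
    rw [diff_apply]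
    exact Subtype.property _
  · intro hx
    obtain ⟨y, hy⟩ := (cov (syz cov M (n + 1))).surjective ⟨x, hx⟩
    exact ⟨y, congrArg Subtype.val hy⟩

theorem ker_diff (n : ℕ) :
    LinearMap.ker (diff cov M n).hom = LinearMap.ker (cov (syz cov M (n + 1))).hom.hom := by
  ext x
  exact ⟨fun h => Subtype.ext h, fun h => congrArg Subtype.val h⟩

/-- The minimal projective resolution built from chosen projective covers. -/
def minimalResolution : MinimalProjectiveResolution M :=
  .ofExact (fun n => (cov (syz cov M n)).obj) (diff cov M) (cov M).hom
    (fun _ => (cov _).projective) (cov M).surjective (range_diff cov M 0)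
    (fun n => (range_diff cov M (n + 1)).trans (ker_diff cov M n).symm)
    (fun n => (range_diff cov M n).symm ▸ (cov _).superfluous)

end ProjectiveCover

end Ring

section Bound

variable {K : Type u} [Field K] {V : Type u} [Quiver.{u, u} V] [Fintype V]
  {I : Ideal (PathAlgebra K V)} [I.IsTwoSided]

theorem PathAlgebra.IsAdmissible.nonempty_projectiveCover (hI : PathAlgebra.IsAdmissible I)
    (M : RightMod (BoundAlgebra I)) : Nonempty (ProjectiveCover M) := by
  obtain ⟨-, n, -, hn⟩ := hI
  obtain ⟨P, _, _, f, hP, hf, hs⟩ := exists_projectiveCover hn M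
  exact ⟨⟨ModuleCat.of _ P, ModuleCat.ofHom f, (IsProjective.iff_projective P).1 hP, hf, hs⟩⟩

theorem PathAlgebra.IsAdmissible.nonempty_minimalProjectiveResolution
    (hI : PathAlgebra.IsAdmissible I) (M : RightMod (BoundAlgebra I)) :
    Nonempty (MinimalProjectiveResolution M) :=
  ⟨ProjectiveCover.minimalResolution (fun M => (hI.nonempty_projectiveCover M).some) M⟩

end Bound

/-! ### Supports of the terms of minimal resolutions -/

namespace FullSubquiver

variable (V : Type u) [Quiver.{u, u} V]

/-- The vertices at which a path of length at least `n` ends. -/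
def longPathTo (n : ℕ) : Set V :=
  {v | ∃ (a : V) (p : Quiver.Path a v), n ≤ p.length}

/-- The vertices at which a path of length at least `n` starts. -/
def longPathFrom (n : ℕ) : Set V :=
  {v | ∃ (a : V) (p : Quiver.Path v a), n ≤ p.length}


variable {V}

theorem succClosed_longPathTo (n : ℕ) : SuccClosed (longPathTo V n) := by
  rintro a b p ⟨c, q, hq⟩
  exact ⟨c, q.comp p, by rw [Quiver.Path.length_comp]; omega⟩

theorem succClosed_compl_longPathFrom (n : ℕ) : SuccClosed (longPathFrom V n)ᶜ := by
  rintro a b p ha ⟨c, q, hq⟩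
  exact ha ⟨c, p.comp q, by rw [Quiver.Path.length_comp]; omega⟩

/-- This fixes the number t+1 of syzygies: one arrow more than the longest path avoiding the heart
forces the path to meet it. -/
theorem longPathTo_subset [Fintype V] : longPathTo V (outerLength V + 1) ⊆ reach (heart V) := by
  rintro v ⟨a, p, hp⟩
  by_contra h
  have := length_le_of_notMem_reach p h
  omega

theorem longPathFrom_subset [Fintype V] : longPathFrom V (outerLength V + 1) ⊆ coreach (heart V) := by
  rintro v ⟨a, p, hp⟩
  by_contra h
  have := length_le_of_notMem_coreach p h
  omega

end FullSubquiver

section Bound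

variable {K : Type u} [Field K] {V : Type u} [Quiver.{u, u} V] [Fintype V]
  {I : Ideal (PathAlgebra K V)} [I.IsTwoSided]

section Module

variable {C D : Type*} [AddCommGroup C] [Module (BoundAlgebra I)ᵐᵒᵖ C]
  [AddCommGroup D] [Module (BoundAlgebra I)ᵐᵒᵖ D]

/-- When no arrow feeds into the component at `v`, only trivial paths act on it from within, so each
`K`-hyperplane of that component pulls back to a submodule of `C`. If `U` had a nonzero component at
`v`, a hyperplane missing it would give a proper supplement. -/
theorem IsSuperfluous.vertexIdem_smul_eq_zero {U : Submodule (BoundAlgebra I)ᵐᵒᵖ C}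
    (hU : IsSuperfluous U) {v : V} (hv : ∀ w, (w ⟶ v) → ∀ x : C, op (vertexIdem I w) • x = 0)
    {x : C} (hx : x ∈ U) : op (vertexIdem I v) • x = 0 := by
  let : Module K C := Module.compHom C (algebraMap K (BoundAlgebra I)ᵐᵒᵖ)
  have hsmul : ∀ (k : K) (m : C), op (algebraMap K (BoundAlgebra I) k) • m = k • m :=
    fun _ _ => rfl
  by_contra h0
  set y := op (vertexIdem I v) • x with hy
  have hyU : y ∈ U := U.smul_mem _ hx
  have hyy : op (vertexIdem I v) • y = y := by
    rw [hy, op_smul_smul, vertexIdem_mul_self]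
  obtain ⟨f, hf⟩ : ∃ f : Module.Dual K C, f y ≠ 0 := by
    by_contra h
    push Not at h
    exact h0 ((Module.forall_dual_apply_eq_zero_iff K y).1 h)
  let W : Submodule (BoundAlgebra I)ᵐᵒᵖ C :=
    { carrier := {z | f (op (vertexIdem I v) • z) = 0}
      zero_mem' := by simp
      add_mem' := fun {a b} (ha : f _ = 0) (hb : f _ = 0) =>
        show f _ = 0 by rw [smul_add, map_add, ha, hb, add_zero]
      smul_mem' := fun r z (hz : f _ = 0) => show f _ = 0 by
        obtain ⟨r, rfl⟩ := op_surjective r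
        obtain ⟨k, hk⟩ := exists_smul_vertexIdem_smul (C := C) r v
        rw [hk z hv, hsmul, map_smul, hz, smul_zero] }
  have hW : W = ⊤ := by
    refine hU W (eq_top_iff.2 fun z _ => ?_)
    -- The multiple of `y` is chosen so that the remainder of `z` is killed by the functional `f`.
    refine Submodule.mem_sup.2 ⟨op (algebraMap K (BoundAlgebra I)
      (f (op (vertexIdem I v) • z) / f y)) • y, U.smul_mem _ hyU, _, ?_, add_sub_cancel _ z⟩
    change f _ = 0
    rw [smul_sub, op_smul_smul, Algebra.commutes, ← op_smul_smul, hyy, hsmul, map_sub, f.map_smul,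
      smul_eq_mul, div_mul_cancel₀ _ hf, sub_self]
  refine hf ?_
  have : y ∈ W := hW ▸ Submodule.mem_top
  rwa [← hyy]

/-- An element at `v` on which all outgoing arrows vanish spans a submodule of `K`-dimension at most
one. An essential `U` must meet it if it is nonzero, and then contains it. -/
theorem IsEssentialSub.vertexIdem_smul_mem {U : Submodule (BoundAlgebra I)ᵐᵒᵖ C}
    (hU : IsEssentialSub U) {v : V} (hv : ∀ w, (v ⟶ w) → ∀ x : C, op (vertexIdem I w) • x = 0)
    (x : C) : op (vertexIdem I v) • x ∈ U := by
  set y := op (vertexIdem I v) • x with hy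
  have hyy : op (vertexIdem I v) • y = y := by
    rw [hy, op_smul_smul, vertexIdem_mul_self]
  by_contra hyU
  have h := hU (Submodule.span _ {y}) ?_
  · rw [Submodule.span_singleton_eq_bot] at h
    exact hyU (h ▸ zero_mem _)
  · refine (Submodule.eq_bot_iff _).2 ?_
    rintro z ⟨hzU, hz⟩
    obtain ⟨r, rfl⟩ := Submodule.mem_span_singleton.1 hz
    obtain ⟨r, rfl⟩ := op_surjective r
    obtain ⟨k, hk⟩ := exists_smul_of_vertexIdem_smul_eq r hyy hv
    have hzU' : op r • y ∈ U := hzU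
    rw [hk] at hzU' ⊢
    by_cases h0 : k = 0
    · rw [h0, map_zero, MulOpposite.op_zero, zero_smul]
    · refine absurd ?_ hyU
      have h1 := U.smul_mem (op (algebraMap K (BoundAlgebra I) k⁻¹)) hzU'
      rwa [op_smul_smul, ← map_mul, mul_inv_cancel₀ h0, map_one, MulOpposite.op_one,
        one_smul] at h1

/-- The source of a map with superfluous kernel is supported where the image is. -/
theorem SupportedIn.of_isSuperfluous_ker {S : Set V} (hS : SuccClosed S)
    (f : C →ₗ[(BoundAlgebra I)ᵐᵒᵖ] D) (hf : IsSuperfluous (LinearMap.ker f))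
    (h : ∀ v ∉ S, ∀ x, op (vertexIdem I v) • f x = 0) : SupportedIn I S C := by
  have hW : supportSub I C S hS = ⊤ := by
    refine hf _ (eq_top_iff.2 fun x _ => ?_)
    rw [← sum_vertexIdem_smul I x]
    refine Submodule.sum_mem _ fun v _ => ?_
    by_cases hv : v ∈ S
    · exact Submodule.mem_sup_right (vertexIdem_smul_mem_supportSub hS hv x)
    · refine Submodule.mem_sup_left ?_
      rw [LinearMap.mem_ker, map_smul, h v hv]
  intro v hv x
  exact (hW ▸ Submodule.mem_top : x ∈ supportSub I C S hS) v hv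

/-- A module is supported where an essential submodule is. -/
theorem SupportedIn.of_isEssentialSub {S : Set V} (hS : SuccClosed Sᶜ)
    {U : Submodule (BoundAlgebra I)ᵐᵒᵖ C} (hU : IsEssentialSub U)
    (h : ∀ v ∉ S, ∀ x ∈ U, op (vertexIdem I v) • x = 0) : SupportedIn I S C := by
  have hW : supportSub I C Sᶜ hS = ⊥ := by
    refine hU _ ((Submodule.eq_bot_iff _).2 ?_)
    rintro x ⟨hxU, hx⟩
    refine eq_zero_of_vertexIdem_smul I fun v => ?_
    by_cases hv : v ∈ S
    · exact hx v (fun h => h hv)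
    · exact h v hv x hxU
  intro v hv x
  have hx := vertexIdem_smul_mem_supportSub (I := I) hS (show v ∈ Sᶜ from hv) x
  rwa [hW] at hx

end Module

/-- A superfluous image has a component at `v` only if an arrow into `v` starts in the support of
the ambient term, which lengthens the path by one. The next term covers that image with superfluous
kernel, so its support stays inside the same successor-closed set. -/
theorem MinimalProjectiveResolution.supportedIn_X {M : RightMod (BoundAlgebra I)}
    (P : MinimalProjectiveResolution M) (n : ℕ) :
    SupportedIn I (longPathTo V n) (P.complex.X n) := by
  induction n with
  | zero => exact fun v hv => absurd ⟨v, Quiver.Path.nil, Nat.zero_le _⟩ hv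
  | succ n ih =>
    refine .of_isSuperfluous_ker (succClosed_longPathTo _) (P.complex.d (n + 1) n).hom ?_ ?_
    · rw [← (P.exact_succ n).moduleCat_range_eq_ker]
      exact P.minimal (n + 1)
    · intro v hv x
      refine (P.minimal n).vertexIdem_smul_eq_zero (fun w f => ih w ?_) ⟨x, rfl⟩
      rintro ⟨a, p, hp⟩
      exact hv ⟨a, p.cons f, Nat.succ_le_succ hp⟩

/-- Dual: components where no outgoing arrow reaches the support lie in the essential kernel and
vanish in the next cosyzygy, and a module has no support beyond predecessors of the support of an
essential submodule. -/
theorem MinimalInjectiveResolution.supportedIn_X {N : RightMod (BoundAlgebra I)}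
    (J : MinimalInjectiveResolution N) (n : ℕ) :
    SupportedIn I (longPathFrom V n) (J.cocomplex.X n) := by
  induction n with
  | zero => exact fun v hv => absurd ⟨v, Quiver.Path.nil, Nat.zero_le _⟩ hv
  | succ n ih =>
    refine .of_isEssentialSub (succClosed_compl_longPathFrom _) (J.minimal (n + 1)) ?_
    rw [← (J.exact_succ n).moduleCat_range_eq_ker]
    rintro v hv _ ⟨x, rfl⟩
    have h := (J.minimal n).vertexIdem_smul_mem (v := v) (fun w f => ih w ?_) x
    · exact ((J.cocomplex.d n (n + 1)).hom.map_smul _ _).symm.trans h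
    · rintro ⟨a, p, hp⟩
      exact hv ⟨a, f.toPath.comp p, by
        rw [Quiver.Path.length_comp, Quiver.Path.length_toPath]; omega⟩

theorem MinimalProjectiveResolution.supportedIn_syzygy {M : RightMod (BoundAlgebra I)}
    (P : MinimalProjectiveResolution M) :
    SupportedIn I (reach (heart V)) (P.syzygy (outerLength V + 1)) :=
  ((P.supportedIn_X _).mono longPathTo_subset).of_surjective
    (P.complex.pOpcycles (outerLength V + 1)).hom
    ((ModuleCat.epi_iff_surjective _).1 inferInstance)

theorem MinimalInjectiveResolution.supportedIn_cosyzygy {N : RightMod (BoundAlgebra I)}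
    (J : MinimalInjectiveResolution N) :
    SupportedIn I (coreach (heart V)) (J.cosyzygy (outerLength V + 1)) :=
  ((J.supportedIn_X _).mono longPathFrom_subset).of_injective
    (J.cocomplex.iCycles (outerLength V + 1)).hom
    ((ModuleCat.mono_iff_injective _).1 inferInstance)

theorem supportedIn_plusQuot {C : RightMod (BoundAlgebra I)}
    (hC : SupportedIn I (reach (heart V)) C) :
    SupportedIn I (heart V) (plusQuot I (heart V) C) := by
  have h1 : SupportedIn I (reach (heart V)) (plusQuot I (heart V) C) :=
    hC.of_surjective (plusSub I (heart V) C).mkQ (Submodule.mkQ_surjective _)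
  have h2 : SupportedIn I (plus (heart V))ᶜ (C ⧸ plusSub I (heart V) C) := by
    rw [plusSub_eq succClosed_plus_heart]
    exact supportedIn_quotient_supportSub _
  refine (h1.inter h2).mono ?_
  rw [plus_eq]
  exact fun v hv => by_contra fun h => hv.2 ⟨hv.1, h⟩

theorem supportedIn_minusPart {C : RightMod (BoundAlgebra I)}
    (hC : SupportedIn I (coreach (heart V)) C) :
    SupportedIn I (heart V) (minusPart I (heart V) C) := by
  have h1 : SupportedIn I (coreach (heart V)) (minusPart I (heart V) C) :=
    hC.of_injective (minusSub I (heart V) C).subtype (Submodule.subtype_injective _)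
  have h2 : SupportedIn I (minus (heart V))ᶜ (minusSub I (heart V) C) := by
    rw [minusSub_eq succClosed_compl_minus_heart]
    exact supportedIn_supportSub _
  refine (h1.inter h2).mono ?_
  rw [minus_eq]
  exact fun v hv => by_contra fun h => hv.2 ⟨hv.1, h⟩

end Bound

/-! ### Dimension shifting for Ext -/

section Abelian

universe w v u'

variable {𝓐 : Type u'} [Category.{v} 𝓐] [Abelian 𝓐]

namespace CategoryTheory.ShortComplex.ShortExact

variable [HasExt.{w} 𝓐] {S : ShortComplex 𝓐} (hS : S.ShortExact)

include hS

theorem extClass_comp_bijective (Y : 𝓐) (n : ℕ) {m : ℕ} (hm : 1 + n = m)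
    [Subsingleton (Ext S.X₂ Y n)] [Subsingleton (Ext S.X₂ Y m)] :
    Function.Bijective fun x : Ext S.X₁ Y n => hS.extClass.comp x hm := by
  constructor
  · refine (injective_iff_map_eq_zero (hS.extClass.precomp Y hm)).2 fun x hx => ?_
    obtain ⟨y, rfl⟩ := Ext.contravariant_sequence_exact₁ hS Y x hm hx
    rw [Subsingleton.elim y 0, Ext.comp_zero]
  · exact fun x => Ext.contravariant_sequence_exact₃ hS Y x (Subsingleton.elim _ _) hm

theorem comp_extClass_bijective (X : 𝓐) (n : ℕ) {m : ℕ} (hm : n + 1 = m)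
    [Subsingleton (Ext X S.X₂ n)] [Subsingleton (Ext X S.X₂ m)] :
    Function.Bijective fun x : Ext X S.X₃ n => x.comp hS.extClass hm := by
  constructor
  · refine (injective_iff_map_eq_zero (hS.extClass.postcomp X hm)).2 fun x hx => ?_
    obtain ⟨y, rfl⟩ := Ext.covariant_sequence_exact₃ X hS x hm hx
    rw [Subsingleton.elim y 0, Ext.zero_comp]
  · exact fun x => Ext.covariant_sequence_exact₁ X hS x (Subsingleton.elim _ _) hm

theorem mk₀_g_comp_bijective (Y : 𝓐) (h : ∀ n, Subsingleton (Ext S.X₁ Y n)) (n : ℕ) :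
    Function.Bijective fun x : Ext S.X₃ Y n => (Ext.mk₀ S.g).comp x (zero_add n) := by
  constructor
  · refine (injective_iff_map_eq_zero ((Ext.mk₀ S.g).precomp Y (zero_add n))).2 fun x hx => ?_
    cases n with
    -- In degree zero the long exact sequence has no preceding term; injectivity comes from `S.g`
    -- being an epimorphism.
    | zero =>
      have := hS.epi_g
      obtain ⟨f, rfl⟩ := Ext.homEquiv₀.symm.surjective x
      have h0 : Ext.mk₀ (S.g ≫ f) = 0 := by
        rw [← Ext.mk₀_comp_mk₀]
        exact hx
      rw [Ext.mk₀_eq_zero_iff, ← Limits.comp_zero (f := S.g), cancel_epi] at h0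
      rw [h0]
      exact Ext.mk₀_zero ..
    | succ n =>
      obtain ⟨y, rfl⟩ := Ext.contravariant_sequence_exact₃ hS Y x hx (add_comm 1 n)
      rw [(h n).elim y 0, Ext.comp_zero]
  · exact fun x => Ext.contravariant_sequence_exact₂ hS Y x ((h n).elim _ _)

theorem comp_mk₀_f_bijective (X : 𝓐) (h : ∀ n, Subsingleton (Ext X S.X₃ n)) (n : ℕ) :
    Function.Bijective fun x : Ext X S.X₁ n => x.comp (Ext.mk₀ S.f) (add_zero n) := by
  constructor
  · refine (injective_iff_map_eq_zero ((Ext.mk₀ S.f).postcomp X (add_zero n))).2 fun x hx => ?_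
    cases n with
    | zero =>
      have := hS.mono_f
      obtain ⟨f, rfl⟩ := Ext.homEquiv₀.symm.surjective x
      have h0 : Ext.mk₀ (f ≫ S.f) = 0 := by
        rw [← Ext.mk₀_comp_mk₀]
        exact hx
      rw [Ext.mk₀_eq_zero_iff, ← Limits.zero_comp (f := S.f), cancel_mono] at h0
      rw [h0]
      exact Ext.mk₀_zero ..
    | succ n =>
      obtain ⟨y, rfl⟩ := Ext.covariant_sequence_exact₁ X hS x hx rfl
      rw [(h n).elim y 0, Ext.zero_comp]
  · exact fun x => Ext.covariant_sequence_exact₂ X hS x ((h n).elim _ _)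

theorem subsingleton_ext_X₃ (Y : 𝓐) (n : ℕ) [Subsingleton (Ext S.X₁ Y n)]
    [Subsingleton (Ext S.X₂ Y (n + 1))] : Subsingleton (Ext S.X₃ Y (n + 1)) := by
  refine subsingleton_of_forall_eq 0 fun x => ?_
  obtain ⟨y, rfl⟩ := Ext.contravariant_sequence_exact₃ hS Y x (Subsingleton.elim _ _)
    (add_comm 1 n)
  rw [Subsingleton.elim y 0, Ext.comp_zero]

end CategoryTheory.ShortComplex.ShortExact

/-! ### Syzygy sequences of a projective resolution and their Yoneda classes -/

namespace CategoryTheory.ProjectiveResolution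

variable {M M' : 𝓐} (P : ProjectiveResolution M) (P' : ProjectiveResolution M')

/-- The sequence of a syzygy, a term of the resolution and the next syzygy. -/
def syzygyShortComplex (n : ℕ) : ShortComplex 𝓐 :=
  ShortComplex.mk (P.complex.fromOpcycles (n + 1) n) (P.complex.pOpcycles n) (by
    rw [← cancel_epi (P.complex.pOpcycles (n + 1)), HomologicalComplex.p_fromOpcycles_assoc,
      HomologicalComplex.d_pOpcycles, Limits.comp_zero])

theorem syzygyShortComplex_shortExact (n : ℕ) : (P.syzygyShortComplex n).ShortExact where
  exact := by
    have h := ShortComplex.exact_of_g_is_cokernel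
      (ShortComplex.mk _ _ (P.complex.d_pOpcycles (n + 1) n))
      (P.complex.opcyclesIsCokernel (n + 1) n (by simp))
    let α : ShortComplex.mk _ _ (P.complex.d_pOpcycles (n + 1) n) ⟶ P.syzygyShortComplex n :=
      { τ₁ := P.complex.pOpcycles (n + 1)
        τ₂ := 𝟙 _
        τ₃ := 𝟙 _
        comm₁₂ := (P.complex.p_fromOpcycles (n + 1) n).trans (Category.comp_id _).symm
        comm₂₃ := (Category.id_comp _).trans (Category.comp_id _).symm }
    have : Epi α.τ₁ := inferInstanceAs (Epi (P.complex.pOpcycles (n + 1)))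
    have : IsIso α.τ₂ := inferInstanceAs (IsIso (𝟙 _))
    have : Mono α.τ₃ := inferInstanceAs (Mono (𝟙 _))
    exact (ShortComplex.exact_iff_of_epi_of_isIso_of_mono α).1 h
  mono_f := by
    have h1 := (P.exact_succ n).mono_fromOpcycles
    have h2 := P.complex.opcyclesIsoSc'_inv_fromOpcycles (n + 2) (n + 1) n (by simp) (by simp)
    have h3 : P.complex.fromOpcycles (n + 1) n =
        (P.complex.opcyclesIsoSc' (n + 2) (n + 1) n (by simp) (by simp)).hom ≫ _ :=
      (Iso.inv_comp_eq _).1 h2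
    change Mono (P.complex.fromOpcycles (n + 1) n)
    rw [h3]
    exact mono_comp' inferInstance h1
  epi_g := inferInstanceAs (Epi (P.complex.pOpcycles n))

variable {P P'} in
/-- The morphism of short exact sequences induced by a chain map. -/
def syzygyShortComplexMap (φ : P'.complex ⟶ P.complex) (n : ℕ) :
    P'.syzygyShortComplex n ⟶ P.syzygyShortComplex n where
  τ₁ := HomologicalComplex.opcyclesMap φ (n + 1)
  τ₂ := φ.f n
  τ₃ := HomologicalComplex.opcyclesMap φ n
  comm₁₂ := by
    change HomologicalComplex.opcyclesMap φ (n + 1) ≫ P.complex.fromOpcycles (n + 1) n =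
      P'.complex.fromOpcycles (n + 1) n ≫ φ.f n
    rw [← cancel_epi (P'.complex.pOpcycles (n + 1)), HomologicalComplex.p_opcyclesMap_assoc,
      HomologicalComplex.p_fromOpcycles, HomologicalComplex.p_fromOpcycles_assoc, φ.comm]
  comm₂₃ := (HomologicalComplex.p_opcyclesMap φ n).symm

/-- The augmentation of a projective resolution. -/
def augmentation : P.complex.X 0 ⟶ M := P.π.f 0

instance : Epi P.augmentation := Limits.epi_of_isColimit_cofork P.isColimitCokernelCofork

theorem d_comp_augmentation : P.complex.d 1 0 ≫ P.augmentation = 0 := P.complex_d_comp_π_f_zero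

/-- The augmentation from the zeroth syzygy. -/
def fromSyzygyZero : P.complex.opcycles 0 ⟶ M :=
  P.complex.descOpcycles P.augmentation 1 (by simp) P.d_comp_augmentation

instance : IsIso P.fromSyzygyZero :=
  (ChainComplex.isIso_descOpcycles_iff _ _ _).2 ⟨P.exact₀, inferInstance⟩

variable {P P'} in
theorem opcyclesMap_comp_fromSyzygyZero {φ : P'.complex ⟶ P.complex} {f : M' ⟶ M}
    (h : φ ≫ P.π = P'.π ≫ (ChainComplex.single₀ 𝓐).map f) :
    HomologicalComplex.opcyclesMap φ 0 ≫ P.fromSyzygyZero = P'.fromSyzygyZero ≫ f := by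
  have h0 : φ.f 0 ≫ P.augmentation = P'.augmentation ≫ f := by
    have := congrArg (fun g => HomologicalComplex.Hom.f g 0) h
    simp at this
    exact this
  rw [← cancel_epi (P'.complex.pOpcycles 0), HomologicalComplex.p_opcyclesMap_assoc,
    fromSyzygyZero, fromSyzygyZero, HomologicalComplex.p_descOpcycles,
    HomologicalComplex.p_descOpcycles_assoc, h0]

variable [HasExt.{w} 𝓐]

/-- The class of the extension of a syzygy by the next one. -/
def syzygyExt (n : ℕ) : Ext (P.complex.opcycles n) (P.complex.opcycles (n + 1)) 1 :=
  (P.syzygyShortComplex_shortExact n).extClass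

variable {P P'} in
theorem syzygyExt_naturality (φ : P'.complex ⟶ P.complex) (n : ℕ) :
    (P'.syzygyExt n).comp (Ext.mk₀ (HomologicalComplex.opcyclesMap φ (n + 1))) (add_zero 1) =
      (Ext.mk₀ (HomologicalComplex.opcyclesMap φ n)).comp (P.syzygyExt n) (zero_add 1) :=
  (P'.syzygyShortComplex_shortExact n).extClass_naturality
    (P.syzygyShortComplex_shortExact n) (syzygyShortComplexMap φ n)

/-- Degree `j` must be positive, because Ext out of the projective middle term has to vanish in both
degrees `j` and `j + 1`. -/
theorem syzygyExt_comp_bijective (Y : 𝓐) (n : ℕ) {j m : ℕ} (hj : 1 ≤ j) (hm : 1 + j = m) :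
    Function.Bijective
      fun x : Ext (P.complex.opcycles (n + 1)) Y j => (P.syzygyExt n).comp x hm := by
  have : Projective (P.syzygyShortComplex n).X₂ := P.projective n
  obtain ⟨j, rfl⟩ : ∃ i, j = i + 1 := ⟨j - 1, by omega⟩
  obtain rfl : m = j + 1 + 1 := by omega
  have := Ext.subsingleton_of_projective (P.syzygyShortComplex n).X₂ Y j
  have := Ext.subsingleton_of_projective (P.syzygyShortComplex n).X₂ Y (j + 1)
  exact (P.syzygyShortComplex_shortExact n).extClass_comp_bijective Y (j + 1) hm

/-- The class of the exact sequence formed by the first `n` terms of a projective resolution. -/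
def syzygyClass : ∀ n : ℕ, Ext M (P.complex.opcycles n) n
  | 0 => Ext.mk₀ (inv P.fromSyzygyZero)
  | n + 1 => (syzygyClass n).comp (P.syzygyExt n) rfl

variable {P P'} in
theorem syzygyClass_naturality {φ : P'.complex ⟶ P.complex} {f : M' ⟶ M}
    (h : φ ≫ P.π = P'.π ≫ (ChainComplex.single₀ 𝓐).map f) (n : ℕ) :
    (P'.syzygyClass n).comp (Ext.mk₀ (HomologicalComplex.opcyclesMap φ n)) (add_zero n) =
      (Ext.mk₀ f).comp (P.syzygyClass n) (zero_add n) := by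
  induction n with
  | zero =>
    rw [syzygyClass, syzygyClass, Ext.mk₀_comp_mk₀, Ext.mk₀_comp_mk₀]
    congr 1
    rw [IsIso.eq_comp_inv, Category.assoc, opcyclesMap_comp_fromSyzygyZero h,
      IsIso.inv_hom_id_assoc]
  | succ n ih =>
    rw [syzygyClass, syzygyClass, Ext.comp_assoc_of_third_deg_zero, syzygyExt_naturality,
      ← Ext.comp_assoc_of_second_deg_zero, ih, Ext.comp_assoc _ _ _ _ _ (by omega)]

theorem syzygyClass_comp_bijective (Y : 𝓐) (n : ℕ) {j m : ℕ} (hj : 1 ≤ j) (hm : n + j = m) :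
    Function.Bijective fun x : Ext (P.complex.opcycles n) Y j => (P.syzygyClass n).comp x hm := by
  induction n generalizing j m with
  | zero =>
    obtain rfl : j = m := by omega
    refine Function.bijective_iff_has_inverse.2
      ⟨fun x => (Ext.mk₀ P.fromSyzygyZero).comp x (zero_add j), fun x => ?_, fun x => ?_⟩
    · simp only [syzygyClass]
      rw [Ext.mk₀_comp_mk₀_assoc, IsIso.hom_inv_id, Ext.mk₀_id_comp]
    · simp only [syzygyClass]
      rw [Ext.mk₀_comp_mk₀_assoc, IsIso.inv_hom_id, Ext.mk₀_id_comp]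
  | succ n ih =>
    have h := (ih (j := j + 1) (m := m) (by omega) (by omega)).comp
      (P.syzygyExt_comp_bijective Y n hj (add_comm 1 j))
    convert h using 1
    funext x
    exact Ext.comp_assoc _ _ _ _ _ (by omega)

end CategoryTheory.ProjectiveResolution

/-! ### Cosyzygy sequences of an injective coresolution and their Yoneda classes -/

namespace CategoryTheory.InjectiveResolution

variable {N N' : 𝓐} (J : InjectiveResolution N) (J' : InjectiveResolution N')

/-- The sequence of a cosyzygy, a term of the coresolution and the next cosyzygy. -/
def cosyzygyShortComplex (n : ℕ) : ShortComplex 𝓐 :=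
  ShortComplex.mk (J.cocomplex.iCycles n) (J.cocomplex.toCycles n (n + 1)) (by
    rw [← cancel_mono (J.cocomplex.iCycles (n + 1)), Category.assoc,
      HomologicalComplex.toCycles_i, HomologicalComplex.iCycles_d, Limits.zero_comp])

theorem cosyzygyShortComplex_shortExact (n : ℕ) : (J.cosyzygyShortComplex n).ShortExact where
  exact := by
    have h := ShortComplex.exact_of_f_is_kernel
      (ShortComplex.mk _ _ (J.cocomplex.iCycles_d n (n + 1)))
      (J.cocomplex.cyclesIsKernel n (n + 1) (by simp))
    let α : J.cosyzygyShortComplex n ⟶ ShortComplex.mk _ _ (J.cocomplex.iCycles_d n (n + 1)) :=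
      { τ₁ := 𝟙 _
        τ₂ := 𝟙 _
        τ₃ := J.cocomplex.iCycles (n + 1)
        comm₁₂ := (Category.id_comp _).trans (Category.comp_id _).symm
        comm₂₃ := (Category.id_comp _).trans (J.cocomplex.toCycles_i n (n + 1)).symm }
    have : Epi α.τ₁ := inferInstanceAs (Epi (𝟙 _))
    have : IsIso α.τ₂ := inferInstanceAs (IsIso (𝟙 _))
    have : Mono α.τ₃ := inferInstanceAs (Mono (J.cocomplex.iCycles (n + 1)))
    exact (ShortComplex.exact_iff_of_epi_of_isIso_of_mono α).2 h
  mono_f := inferInstanceAs (Mono (J.cocomplex.iCycles n))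
  epi_g := by
    have h1 := (J.exact_succ n).epi_toCycles
    have h2 := J.cocomplex.toCycles_cyclesIsoSc'_hom n (n + 1) (n + 2) (by simp) (by simp)
    have h3 : J.cocomplex.toCycles n (n + 1) = _ ≫
        (J.cocomplex.cyclesIsoSc' n (n + 1) (n + 2) (by simp) (by simp)).inv :=
      (Iso.eq_comp_inv _).2 h2
    change Epi (J.cocomplex.toCycles n (n + 1))
    rw [h3]
    exact epi_comp' h1 inferInstance

variable {J J'} in
/-- The morphism of short exact sequences induced by a cochain map. -/
def cosyzygyShortComplexMap (ψ : J.cocomplex ⟶ J'.cocomplex) (n : ℕ) :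
    J.cosyzygyShortComplex n ⟶ J'.cosyzygyShortComplex n where
  τ₁ := HomologicalComplex.cyclesMap ψ n
  τ₂ := ψ.f n
  τ₃ := HomologicalComplex.cyclesMap ψ (n + 1)
  comm₁₂ := HomologicalComplex.cyclesMap_i ψ n
  comm₂₃ := by
    change ψ.f n ≫ J'.cocomplex.toCycles n (n + 1) =
      J.cocomplex.toCycles n (n + 1) ≫ HomologicalComplex.cyclesMap ψ (n + 1)
    rw [← cancel_mono (J'.cocomplex.iCycles (n + 1)), Category.assoc, Category.assoc,
      HomologicalComplex.cyclesMap_i, HomologicalComplex.toCycles_i,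
      HomologicalComplex.toCycles_i_assoc, ψ.comm]

/-- The coaugmentation of an injective coresolution. -/
def coaugmentation : N ⟶ J.cocomplex.X 0 := J.ι.f 0

instance : Mono J.coaugmentation := Limits.mono_of_isLimit_fork J.isLimitKernelFork

theorem coaugmentation_comp_d : J.coaugmentation ≫ J.cocomplex.d 0 1 = 0 :=
  J.ι_f_zero_comp_complex_d

/-- The coaugmentation to the zeroth cosyzygy. -/
def toCosyzygyZero : N ⟶ J.cocomplex.cycles 0 :=
  J.cocomplex.liftCycles J.coaugmentation 1 (by simp) J.coaugmentation_comp_d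

instance : IsIso J.toCosyzygyZero :=
  (CochainComplex.isIso_liftCycles_iff _ _ _).2 ⟨J.exact₀, inferInstance⟩

variable {J J'} in
theorem toCosyzygyZero_comp_cyclesMap {ψ : J.cocomplex ⟶ J'.cocomplex} {g : N ⟶ N'}
    (h : J.ι ≫ ψ = (CochainComplex.single₀ 𝓐).map g ≫ J'.ι) :
    J.toCosyzygyZero ≫ HomologicalComplex.cyclesMap ψ 0 = g ≫ J'.toCosyzygyZero := by
  have h0 : J.coaugmentation ≫ ψ.f 0 = g ≫ J'.coaugmentation := by
    have := congrArg (fun g => HomologicalComplex.Hom.f g 0) h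
    simp at this
    exact this
  rw [← cancel_mono (J'.cocomplex.iCycles 0), Category.assoc, Category.assoc,
    HomologicalComplex.cyclesMap_i, toCosyzygyZero, toCosyzygyZero,
    HomologicalComplex.liftCycles_i, HomologicalComplex.liftCycles_i_assoc, h0]

variable [HasExt.{w} 𝓐]

/-- The class of the extension of a cosyzygy by the preceding one. -/
def cosyzygyExt (n : ℕ) : Ext (J.cocomplex.cycles (n + 1)) (J.cocomplex.cycles n) 1 :=
  (J.cosyzygyShortComplex_shortExact n).extClass

variable {J J'} in
theorem cosyzygyExt_naturality (ψ : J.cocomplex ⟶ J'.cocomplex) (n : ℕ) :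
    (J.cosyzygyExt n).comp (Ext.mk₀ (HomologicalComplex.cyclesMap ψ n)) (add_zero 1) =
      (Ext.mk₀ (HomologicalComplex.cyclesMap ψ (n + 1))).comp (J'.cosyzygyExt n) (zero_add 1) :=
  (J.cosyzygyShortComplex_shortExact n).extClass_naturality
    (J'.cosyzygyShortComplex_shortExact n) (cosyzygyShortComplexMap ψ n)

theorem comp_cosyzygyExt_bijective (X : 𝓐) (n : ℕ) {j m : ℕ} (hj : 1 ≤ j) (hm : j + 1 = m) :
    Function.Bijective
      fun x : Ext X (J.cocomplex.cycles (n + 1)) j => x.comp (J.cosyzygyExt n) hm := by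
  have : Injective (J.cosyzygyShortComplex n).X₂ := J.injective n
  obtain ⟨j, rfl⟩ : ∃ i, j = i + 1 := ⟨j - 1, by omega⟩
  obtain rfl : m = j + 1 + 1 := by omega
  have := Ext.subsingleton_of_injective X (J.cosyzygyShortComplex n).X₂ j
  have := Ext.subsingleton_of_injective X (J.cosyzygyShortComplex n).X₂ (j + 1)
  exact (J.cosyzygyShortComplex_shortExact n).comp_extClass_bijective X (j + 1) hm

/-- The class of the exact sequence formed by the first `n` terms of an injective
coresolution. -/
def cosyzygyClass : ∀ n : ℕ, Ext (J.cocomplex.cycles n) N n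
  | 0 => Ext.mk₀ (inv J.toCosyzygyZero)
  | n + 1 => (J.cosyzygyExt n).comp (cosyzygyClass n) (add_comm 1 n)

variable {J J'} in
theorem cosyzygyClass_naturality {ψ : J.cocomplex ⟶ J'.cocomplex} {g : N ⟶ N'}
    (h : J.ι ≫ ψ = (CochainComplex.single₀ 𝓐).map g ≫ J'.ι) (n : ℕ) :
    (J.cosyzygyClass n).comp (Ext.mk₀ g) (add_zero n) =
      (Ext.mk₀ (HomologicalComplex.cyclesMap ψ n)).comp (J'.cosyzygyClass n) (zero_add n) := by
  induction n with
  | zero =>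
    rw [cosyzygyClass, cosyzygyClass, Ext.mk₀_comp_mk₀, Ext.mk₀_comp_mk₀]
    congr 1
    rw [IsIso.inv_comp_eq, ← Category.assoc, toCosyzygyZero_comp_cyclesMap h, Category.assoc,
      IsIso.hom_inv_id, Category.comp_id]
  | succ n ih =>
    rw [cosyzygyClass, cosyzygyClass, Ext.comp_assoc_of_third_deg_zero, ih,
      ← Ext.comp_assoc_of_second_deg_zero, cosyzygyExt_naturality,
      Ext.comp_assoc _ _ _ _ _ (by omega)]

theorem comp_cosyzygyClass_bijective (X : 𝓐) (n : ℕ) {j m : ℕ} (hj : 1 ≤ j) (hm : j + n = m) :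
    Function.Bijective fun x : Ext X (J.cocomplex.cycles n) j => x.comp (J.cosyzygyClass n) hm := by
  induction n generalizing j m with
  | zero =>
    obtain rfl : j = m := by omega
    refine Function.bijective_iff_has_inverse.2
      ⟨fun x => x.comp (Ext.mk₀ J.toCosyzygyZero) (add_zero j), fun x => ?_, fun x => ?_⟩
    · simp only [cosyzygyClass]
      rw [Ext.comp_assoc_of_third_deg_zero, Ext.mk₀_comp_mk₀, IsIso.inv_hom_id, Ext.comp_mk₀_id]
    · simp only [cosyzygyClass]
      rw [Ext.comp_assoc_of_third_deg_zero, Ext.mk₀_comp_mk₀, IsIso.hom_inv_id, Ext.comp_mk₀_id]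
  | succ n ih =>
    have h := (ih (j := j + 1) (m := m) (by omega) (by omega)).comp
      (J.comp_cosyzygyExt_bijective X n hj rfl)
    convert h using 1
    funext x
    exact (Ext.comp_assoc _ _ _ _ _ (by omega)).symm

end CategoryTheory.InjectiveResolution

end Abelian

/-! ### Exact fully faithful functors and Ext -/

section Abelian

open Limits

universe w w' v v' u₁ u₂

variable {𝓒 : Type u₁} [Category.{v} 𝓒] [Abelian 𝓒] {𝓓 : Type u₂} [Category.{v'} 𝓓] [Abelian 𝓓]

/-- A fully faithful exact functor induces bijections `Ext X Y n → Ext (F X) (F Y) n` if the images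
of the projective objects are acyclic for `Hom(-, F Y)`. -/
theorem CategoryTheory.Functor.mapExt_bijective_of_acyclic (F : 𝓒 ⥤ 𝓓) [F.Additive]
    [PreservesFiniteLimits F] [PreservesFiniteColimits F] [F.Full] [F.Faithful] [HasExt.{w} 𝓒]
    [HasExt.{w'} 𝓓] [EnoughProjectives 𝓒] (Y : 𝓒)
    (h : ∀ (P : 𝓒) [Projective P] (n : ℕ), Subsingleton (Ext (F.obj P) (F.obj Y) (n + 1)))
    (X : 𝓒) (n : ℕ) : Function.Bijective (F.mapExtAddHom X Y n) := by
  induction n generalizing X with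
  | zero =>
    simpa [Ext.mapExactFunctor₀] using ⟨Functor.Faithful.map_injective, Functor.Full.map_surjective⟩
  | succ n hn =>
    let P : ProjectivePresentation X := Classical.arbitrary _
    have := P.projective
    let S := ShortComplex.mk _ _ (kernel.condition P.f)
    have : Projective S.X₂ := P.projective
    have := h P.p n
    have : Subsingleton (Ext (S.map F).X₂ (F.obj Y) (n + 1)) := h P.p n
    have : Subsingleton (Ext S.X₂ Y (n + 1)) := Ext.subsingleton_of_projective _ _ _
    have hS : S.ShortExact := { exact := ShortComplex.exact_kernel P.f }
    -- With S the sequence of a projective cover-up of `X`, Ext in degree n+1 out of `X` is the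
    -- cokernel of Ext in degree n from `S.X₂` to `S.X₁`, before and after applying `F`; acyclicity
    -- is what gives the second presentation.
    exact AddMonoidHom.bijective_of_surjective_of_bijective_of_right_exact _ _ _ _
      (F.mapExtAddHom S.X₂ Y n) (F.mapExtAddHom S.X₁ Y n) (F.mapExtAddHom S.X₃ Y (n + 1))
      (by ext; simp [Ext.mapExactFunctor_comp, Ext.mapExactFunctor_mk₀]; rfl)
      (by ext; simp [Ext.mapExactFunctor_comp, Ext.mapExactFunctor_extClass]; rfl)
      ((ShortComplex.ab_exact_iff_function_exact _).1
        (Ext.contravariant_sequence_exact₁' hS Y n (n + 1) (add_comm 1 n)))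
      ((ShortComplex.ab_exact_iff_function_exact _).1
        (Ext.contravariant_sequence_exact₁' (hS.map F) (F.obj Y) n (n + 1) (add_comm 1 n)))
      (hn _).surjective (hn _)
      (fun x₃ ↦ Ext.contravariant_sequence_exact₃ hS _ x₃ (Subsingleton.elim _ _) (add_comm 1 n))
      (fun y₃ ↦ Ext.contravariant_sequence_exact₃ (hS.map F) _ y₃ (Subsingleton.elim _ _)
        (add_comm 1 n))

end Abelian

/-! ### Exactness and fullness of restriction of scalars -/

namespace ModuleCat

universe v u₁ u₂

variable {R : Type u₁} [Ring R] {S : Type u₂} [Ring S] (f : R →+* S)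

theorem exact_map_restrictScalars (T : ShortComplex (ModuleCat.{v} S)) (h : T.Exact) :
    (T.map (restrictScalars.{v} f)).Exact := by
  rw [ShortComplex.ShortExact.moduleCat_exact_iff_function_exact] at h ⊢
  exact h

theorem preservesFiniteLimits_restrictScalars :
    Limits.PreservesFiniteLimits (restrictScalars.{v} f) := by
  have := ((Functor.exact_tfae (restrictScalars.{v} f)).out 1 3).mp (exact_map_restrictScalars f)
  exact this.1

theorem preservesFiniteColimits_restrictScalars :
    Limits.PreservesFiniteColimits (restrictScalars.{v} f) := by
  have := ((Functor.exact_tfae (restrictScalars.{v} f)).out 1 3).mp (exact_map_restrictScalars f)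
  exact this.2

theorem full_restrictScalars (hf : Function.Surjective f) : (restrictScalars.{v} f).Full where
  map_surjective {A B} g := ⟨ModuleCat.ofHom
    { toFun := fun a => g.hom a
      map_add' := fun a b => map_add g.hom a b
      map_smul' := fun r a => by
        obtain ⟨r, rfl⟩ := hf r
        exact g.hom.map_smul r a }, rfl⟩

end ModuleCat

section Bound

variable {K : Type u} [Field K] {V : Type u} [Quiver.{u, u} V] [Fintype V]
  (I : Ideal (PathAlgebra K V)) [I.IsTwoSided]

/-! ### Inflation of modules along `Λ ⟶ Λ / ⟨e'⟩` -/

/-- The quotient map of the opposite algebras. -/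
def assocMap (L : Set V) : (BoundAlgebra I)ᵐᵒᵖ →ₐ[K] (AssocAlgebra I L)ᵐᵒᵖ :=
  AlgHom.op (Ideal.Quotient.mkₐ K (outerIdeal I L))

theorem assocMap_surjective (L : Set V) : Function.Surjective (assocMap I L) := by
  intro r
  obtain ⟨x, hx⟩ := Ideal.Quotient.mk_surjective (unop r)
  exact ⟨op x, unop_injective hx⟩

/-- A right `Γ`-module, viewed as a right `Λ`-module. -/
abbrev inflation (L : Set V) : RightMod (AssocAlgebra I L) ⥤ RightMod (BoundAlgebra I) :=
  ModuleCat.restrictScalars (assocMap I L).toRingHom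

instance (L : Set V) : (inflation I L).Linear K := inferInstance

instance (L : Set V) : Limits.PreservesFiniteLimits (inflation I L) :=
  ModuleCat.preservesFiniteLimits_restrictScalars _

instance (L : Set V) : Limits.PreservesFiniteColimits (inflation I L) :=
  ModuleCat.preservesFiniteColimits_restrictScalars _

instance (L : Set V) : (inflation I L).Full :=
  ModuleCat.full_restrictScalars _ (assocMap_surjective I L)

instance (L : Set V) : (inflation I L).Faithful := inferInstance

theorem supportedIn_inflation {L : Set V} (A : RightMod (AssocAlgebra I L)) :
    SupportedIn I L ((inflation I L).obj A) := by
  intro v hv a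
  change (op (Ideal.Quotient.mk (outerIdeal I L) (vertexIdem I v)) • a : A) = 0
  rw [Ideal.Quotient.eq_zero_iff_mem.2 (vertexIdem_mem_outerIdeal hv), MulOpposite.op_zero,
    zero_smul]

variable {I}

theorem SupportedIn.isAssocModule {L : Set V} {C : RightMod (BoundAlgebra I)}
    (h : SupportedIn I L C) : IsAssocModule I L C := fun _ hx c => h.outerIdeal_smul hx c

theorem supportedIn_inflation_heart_compl_plus (A : RightMod (AssocAlgebra I (heart V))) :
    SupportedIn I (plus (heart V))ᶜ ((inflation I (heart V)).obj A) :=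
  (supportedIn_inflation I A).mono fun _ hv h => h.1 hv

/-- The projection `C ⟶ C / C⁺`, where `C / C⁺` comes from a `Γ`-module. -/
def toPlusQuot {L : Set V} {C : RightMod (BoundAlgebra I)}
    (h : IsAssocModule I L (plusQuot I L C)) : C ⟶ (inflation I L).obj (toAssoc _ h) :=
  ModuleCat.ofHom (Y := (inflation I L).obj (toAssoc _ h))
    { toFun := fun c => (plusSub I L C).mkQ c
      map_add' := fun c d => map_add (plusSub I L C).mkQ c d
      map_smul' := fun r c => map_smul (plusSub I L C).mkQ r c }

variable (I) in
/-- The sequence `0 ⟶ C⁺ ⟶ C ⟶ C / C⁺ ⟶ 0`, where `C / C⁺` comes from a `Γ`-module. -/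
def plusShortComplex (L : Set V) (C : RightMod (BoundAlgebra I))
    (h : IsAssocModule I L (plusQuot I L C)) : ShortComplex (RightMod (BoundAlgebra I)) where
  X₁ := ModuleCat.of _ (plusSub I L C)
  X₂ := C
  X₃ := (inflation I L).obj (toAssoc _ h)
  f := ModuleCat.ofHom (plusSub I L C).subtype
  g := toPlusQuot h
  zero := by
    ext c
    exact (Submodule.Quotient.mk_eq_zero _).2 c.2

theorem plusShortComplex_shortExact (L : Set V) (C : RightMod (BoundAlgebra I))
    (h : IsAssocModule I L (plusQuot I L C)) : (plusShortComplex I L C h).ShortExact where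
  exact := by
    rw [ShortComplex.ShortExact.moduleCat_exact_iff_function_exact]
    intro c
    refine (Submodule.Quotient.mk_eq_zero _).trans ⟨fun hc => ⟨⟨c, hc⟩, rfl⟩, ?_⟩
    rintro ⟨c, rfl⟩
    exact c.2
  mono_f := (ModuleCat.mono_iff_injective _).2 (Submodule.subtype_injective _)
  epi_g := (ModuleCat.epi_iff_surjective _).2 (Submodule.mkQ_surjective _)

theorem toPlusQuot_naturality {L : Set V} {C D : RightMod (BoundAlgebra I)}
    (hC : IsAssocModule I L (plusQuot I L C)) (hD : IsAssocModule I L (plusQuot I L D))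
    (f : C ⟶ D) :
    toPlusQuot hC ≫ (inflation I L).map (toAssocMap hC hD (plusQuotMap L f)) =
      f ≫ toPlusQuot hD := rfl

/-- The inclusion `C₋ ⟶ C`, where `C₋` comes from a `Γ`-module. -/
def fromMinusPart {L : Set V} {C : RightMod (BoundAlgebra I)}
    (h : IsAssocModule I L (minusPart I L C)) : (inflation I L).obj (toAssoc _ h) ⟶ C :=
  ModuleCat.ofHom (X := (inflation I L).obj (toAssoc _ h))
    { toFun := fun c => (minusSub I L C).subtype c
      map_add' := fun c d => map_add (minusSub I L C).subtype c d
      map_smul' := fun r c => map_smul (minusSub I L C).subtype r c }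

variable (I) in
/-- The sequence `0 ⟶ C₋ ⟶ C ⟶ C / C₋ ⟶ 0`, where `C₋` comes from a `Γ`-module. -/
def minusShortComplex (L : Set V) (C : RightMod (BoundAlgebra I))
    (h : IsAssocModule I L (minusPart I L C)) : ShortComplex (RightMod (BoundAlgebra I)) where
  X₁ := (inflation I L).obj (toAssoc _ h)
  X₂ := C
  X₃ := ModuleCat.of _ (C ⧸ minusSub I L C)
  f := fromMinusPart h
  g := ModuleCat.ofHom (minusSub I L C).mkQ
  zero := by
    ext c
    exact (Submodule.Quotient.mk_eq_zero _).2 (Subtype.property (p := (· ∈ minusSub I L C)) c)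

theorem minusShortComplex_shortExact (L : Set V) (C : RightMod (BoundAlgebra I))
    (h : IsAssocModule I L (minusPart I L C)) : (minusShortComplex I L C h).ShortExact where
  exact := by
    rw [ShortComplex.ShortExact.moduleCat_exact_iff_function_exact]
    intro c
    refine (Submodule.Quotient.mk_eq_zero _).trans ⟨fun hc => ⟨(⟨c, hc⟩ : minusSub I L C), rfl⟩, ?_⟩
    rintro ⟨c, rfl⟩
    exact Subtype.property (p := (· ∈ minusSub I L C)) c
  mono_f := (ModuleCat.mono_iff_injective _).2 (Submodule.subtype_injective (minusSub I L C))
  epi_g := (ModuleCat.epi_iff_surjective _).2 (Submodule.mkQ_surjective _)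

theorem fromMinusPart_naturality {L : Set V} {C D : RightMod (BoundAlgebra I)}
    (hC : IsAssocModule I L (minusPart I L C)) (hD : IsAssocModule I L (minusPart I L D))
    (f : C ⟶ D) :
    (inflation I L).map (toAssocMap hC hD (minusPartMap L f)) ≫ fromMinusPart hD =
      fromMinusPart hC ≫ f := rfl

/-! ### Vanishing of Ext -/

/-- The projective cover of `C` and its kernel keep support in `S`, so the degree drops by one at
each step until only Hom between modules of disjoint support is left. -/
theorem SupportedIn.subsingleton_ext (hI : PathAlgebra.IsAdmissible I) {S : Set V}
    (hS : SuccClosed S) {C D : RightMod (BoundAlgebra I)} (hC : SupportedIn I S C)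
    (hD : SupportedIn I Sᶜ D) (n : ℕ) : Subsingleton (Ext C D n) := by
  induction n generalizing C with
  | zero =>
    have : Subsingleton (C ⟶ D) := subsingleton_of_forall_eq 0 fun f =>
      ModuleCat.hom_ext (hC.linearMap_eq_zero hD f.hom)
    exact Ext.homEquiv₀.subsingleton
  | succ n ih =>
    obtain ⟨Q⟩ := hI.nonempty_projectiveCover C
    have hQ : SupportedIn I S Q.obj := .of_isSuperfluous_ker hS Q.hom.hom Q.superfluous
      fun v hv x => hC v hv _
    have := Q.projective
    let T := ShortComplex.mk _ _ (Limits.kernel.condition Q.hom)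
    have : Epi Q.hom := (ModuleCat.epi_iff_surjective _).2 Q.surjective
    have hT : T.ShortExact := { exact := ShortComplex.exact_kernel Q.hom }
    have : Subsingleton (Ext T.X₁ D n) := ih (hQ.of_injective (Limits.kernel.ι Q.hom).hom
      ((ModuleCat.mono_iff_injective _).1 inferInstance))
    have : Subsingleton (Ext T.X₂ D (n + 1)) := Ext.subsingleton_of_projective Q.obj D n
    exact hT.subsingleton_ext_X₃ D n

theorem subsingleton_ext_plusSub (hI : PathAlgebra.IsAdmissible I)
    (C : RightMod (BoundAlgebra I)) {D : RightMod (BoundAlgebra I)}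
    (hD : SupportedIn I (plus (heart V))ᶜ D) (n : ℕ) :
    Subsingleton (Ext (ModuleCat.of _ (plusSub I (heart V) C)) D n) :=
  SupportedIn.subsingleton_ext hI succClosed_plus_heart (supportedIn_plusSub _) hD n

theorem subsingleton_ext_quotient_minusSub (hI : PathAlgebra.IsAdmissible I)
    {C : RightMod (BoundAlgebra I)} (hC : SupportedIn I (minus (heart V))ᶜ C)
    (D : RightMod (BoundAlgebra I)) (n : ℕ) :
    Subsingleton (Ext C (ModuleCat.of _ (D ⧸ minusSub I (heart V) D)) n) :=
  SupportedIn.subsingleton_ext hI succClosed_compl_minus_heart hC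
    (by rw [compl_compl]; exact supportedIn_minusSub _) n

/-- Inflations of projective `Γ`-modules are acyclic for inflations of `Γ`-modules. -/
theorem subsingleton_ext_inflation_of_projective (hI : PathAlgebra.IsAdmissible I)
    (P B : RightMod (AssocAlgebra I (heart V))) [Projective P] (n : ℕ) :
    Subsingleton (Ext ((inflation I (heart V)).obj P) ((inflation I (heart V)).obj B) (n + 1)) := by
  set F := inflation I (heart V)
  obtain ⟨Q⟩ := hI.nonempty_projectiveCover (F.obj P)
  have := Q.projective
  have hQ : SupportedIn I (reach (heart V)) Q.obj :=
    .of_isSuperfluous_ker (succClosed_reach _) Q.hom.hom Q.superfluous fun v hv x =>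
      (supportedIn_inflation I P).mono (subset_reach _) v hv _
  have hA := (supportedIn_plusQuot hQ).isAssocModule
  have hT := plusShortComplex_shortExact (heart V) Q.obj hA
  have : Subsingleton (Ext (plusShortComplex I (heart V) Q.obj hA).X₁ (F.obj B) n) :=
    subsingleton_ext_plusSub hI Q.obj (supportedIn_inflation_heart_compl_plus B) n
  have : Subsingleton (Ext (plusShortComplex I (heart V) Q.obj hA).X₂ (F.obj B) (n + 1)) :=
    Ext.subsingleton_of_projective Q.obj (F.obj B) n
  have hsub : Subsingleton (Ext (F.obj (toAssoc _ hA)) (F.obj B) (n + 1)) :=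
    hT.subsingleton_ext_X₃ (F.obj B) n
  -- The part of the cover in H⁺ has no nonzero map to a module supported on the heart, so the cover
  -- factors through Q/Q⁺, which is a Γ-module.
  have hzero : (plusShortComplex I (heart V) Q.obj hA).f ≫ Q.hom = 0 :=
    ModuleCat.hom_ext (SupportedIn.linearMap_eq_zero (supportedIn_plusSub _)
      (supportedIn_inflation_heart_compl_plus P) _)
  have := hT.epi_g
  let q : F.obj (toAssoc _ hA) ⟶ F.obj P := hT.exact.desc Q.hom hzero
  have hq : (plusShortComplex I (heart V) Q.obj hA).g ≫ q = Q.hom := hT.exact.g_desc _ _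
  have : Epi Q.hom := (ModuleCat.epi_iff_surjective _).2 Q.surjective
  have : Epi ((plusShortComplex I (heart V) Q.obj hA).g ≫ q) := by rwa [hq]
  have : Epi q := epi_of_epi (plusShortComplex I (heart V) Q.obj hA).g q
  have hFq : F.map (F.preimage q) = q := F.map_preimage q
  have : Epi (F.map (F.preimage q)) := by rwa [hFq]
  have : Epi (F.preimage q) := F.epi_of_epi_map this
  -- By fullness `q` is an epimorphism of Γ-modules onto the projective `P`, so it splits; thus the
  -- inflation of `P` is a retract of Q/Q⁺, whose Ext groups vanish.
  let s := Projective.factorThru (𝟙 P) (F.preimage q)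
  have hs : F.map s ≫ q = 𝟙 _ := by
    rw [← hFq, ← F.map_comp, Projective.factorThru_comp, F.map_id]
  refine subsingleton_of_forall_eq 0 fun x => ?_
  rw [← Ext.mk₀_id_comp x, ← hs, ← Ext.mk₀_comp_mk₀_assoc,
    hsub.elim ((Ext.mk₀ q).comp x (zero_add _)) 0, Ext.comp_zero]

theorem mapExt_inflation_bijective (hI : PathAlgebra.IsAdmissible I)
    (A B : RightMod (AssocAlgebra I (heart V))) (n : ℕ) :
    Function.Bijective fun x : Ext A B n => x.mapExactFunctor (inflation I (heart V)) :=
  (inflation I (heart V)).mapExt_bijective_of_acyclic B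
    (fun P _ n => subsingleton_ext_inflation_of_projective hI P B n) A n

end Bound

/-! ### Yoneda classes of minimal resolutions -/

/-- The class of the exact sequence formed by the first `n` terms of the resolution. -/
def MinimalProjectiveResolution.yonedaClass {S : Type u} [Ring S] {M : ModuleCat.{u} S}
    (P : MinimalProjectiveResolution M) (n : ℕ) : Ext M (P.syzygy n) n := P.syzygyClass n

theorem MinimalProjectiveResolution.yonedaClass_naturality {S : Type u} [Ring S]
    {M M' : ModuleCat.{u} S} {P : MinimalProjectiveResolution M}
    {P' : MinimalProjectiveResolution M'} {f : M' ⟶ M} {φ : P'.complex ⟶ P.complex}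
    (h : P'.IsLift P f φ) (n : ℕ) :
    (P'.yonedaClass n).comp (Ext.mk₀ (syzygyMap φ n)) (add_zero n) =
      (Ext.mk₀ f).comp (P.yonedaClass n) (zero_add n) :=
  ProjectiveResolution.syzygyClass_naturality h n

theorem MinimalProjectiveResolution.yonedaClass_comp_bijective {S : Type u} [Ring S]
    {M : ModuleCat.{u} S} (P : MinimalProjectiveResolution M) (Y : ModuleCat.{u} S) (n : ℕ)
    {j m : ℕ} (hj : 1 ≤ j) (hm : n + j = m) :
    Function.Bijective fun x : Ext (P.syzygy n) Y j => (P.yonedaClass n).comp x hm :=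
  P.syzygyClass_comp_bijective Y n hj hm

/-- The class of the exact sequence formed by the first `n` terms of the coresolution. -/
def MinimalInjectiveResolution.yonedaClass {S : Type u} [Ring S] {N : ModuleCat.{u} S}
    (J : MinimalInjectiveResolution N) (n : ℕ) : Ext (J.cosyzygy n) N n := J.cosyzygyClass n

theorem MinimalInjectiveResolution.yonedaClass_naturality {S : Type u} [Ring S]
    {N N' : ModuleCat.{u} S} {J : MinimalInjectiveResolution N}
    {J' : MinimalInjectiveResolution N'} {g : N ⟶ N'} {ψ : J.cocomplex ⟶ J'.cocomplex}
    (h : J.IsLift J' g ψ) (n : ℕ) :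
    (J.yonedaClass n).comp (Ext.mk₀ g) (add_zero n) =
      (Ext.mk₀ (cosyzygyMap ψ n)).comp (J'.yonedaClass n) (zero_add n) :=
  InjectiveResolution.cosyzygyClass_naturality h n

theorem MinimalInjectiveResolution.comp_yonedaClass_bijective {S : Type u} [Ring S]
    {N : ModuleCat.{u} S} (J : MinimalInjectiveResolution N) (X : ModuleCat.{u} S) (n : ℕ)
    {j m : ℕ} (hj : 1 ≤ j) (hm : j + n = m) :
    Function.Bijective fun x : Ext X (J.cosyzygy n) j => x.comp (J.yonedaClass n) hm :=
  J.comp_cosyzygyClass_bijective X n hj hm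

section Bound

variable {K : Type u} [Field K] {V : Type u} [Quiver.{u, u} V] [Fintype V]
  {I : Ideal (PathAlgebra K V)} [I.IsTwoSided]

/-! ### Comparison of Ext over `Λ` and over `Γ` -/

theorem toPlusQuot_comp_bijective (hI : PathAlgebra.IsAdmissible I)
    {C : RightMod (BoundAlgebra I)} (h : IsAssocModule I (heart V) (plusQuot I (heart V) C))
    (B : RightMod (AssocAlgebra I (heart V))) (n : ℕ) :
    Function.Bijective fun x : Ext ((inflation I (heart V)).obj (toAssoc _ h))
        ((inflation I (heart V)).obj B) n =>
      (Ext.mk₀ (toPlusQuot h)).comp x (zero_add n) :=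
  (plusShortComplex_shortExact (heart V) C h).mk₀_g_comp_bijective _
    (fun n => subsingleton_ext_plusSub hI C (supportedIn_inflation_heart_compl_plus B) n) n

/-- Successors of the heart avoid H⁻ by convexity, so Ext from `C` to D/D₋ vanishes in every degree.
-/
theorem comp_fromMinusPart_bijective (hI : PathAlgebra.IsAdmissible I)
    {C D : RightMod (BoundAlgebra I)} (hC : SupportedIn I (reach (heart V)) C)
    (h : IsAssocModule I (heart V) (minusPart I (heart V) D)) (n : ℕ) :
    Function.Bijective fun x : Ext C ((inflation I (heart V)).obj (toAssoc _ h)) n =>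
      x.comp (Ext.mk₀ (fromMinusPart h)) (add_zero n) :=
  (minusShortComplex_shortExact (heart V) D h).comp_mk₀_f_bijective _
    (fun n => subsingleton_ext_quotient_minusSub hI
      (hC.mono fun _ hv h => (minus_heart.subset h).2 hv) D n) n

theorem MinimalProjectiveResolution.isAssocModule {M : RightMod (BoundAlgebra I)}
    (P : MinimalProjectiveResolution M) :
    IsAssocModule I (heart V) (plusQuot I (heart V) (P.syzygy (outerLength V + 1))) :=
  (supportedIn_plusQuot P.supportedIn_syzygy).isAssocModule

theorem MinimalInjectiveResolution.isAssocModule {N : RightMod (BoundAlgebra I)}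
    (J : MinimalInjectiveResolution N) :
    IsAssocModule I (heart V) (minusPart I (heart V) (J.cosyzygy (outerLength V + 1))) :=
  (supportedIn_minusPart J.supportedIn_cosyzygy).isAssocModule

/-- The inflation of an extension of `Γ`-modules, pulled back to `C` and pushed out to `D`. -/
def innerExtMap {C D : RightMod (BoundAlgebra I)} {L : Set V}
    (hC : IsAssocModule I L (plusQuot I L C)) (hD : IsAssocModule I L (minusPart I L D)) (j : ℕ) :
    Ext (toAssoc _ hC) (toAssoc _ hD) j →ₗ[K] Ext C D j where
  toFun x := ((Ext.mk₀ (toPlusQuot hC)).comp (x.mapExactFunctor (inflation I L))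
    (zero_add j)).comp (Ext.mk₀ (fromMinusPart hD)) (add_zero j)
  map_add' x y := by
    rw [Ext.mapExactFunctor_add, Ext.comp_add, Ext.add_comp]
  map_smul' r x := by
    rw [Functor.mapExactFunctor_smul, Ext.comp_smul, Ext.smul_comp, RingHom.id_apply]

theorem innerExtMap_apply {C D : RightMod (BoundAlgebra I)} {L : Set V}
    (hC : IsAssocModule I L (plusQuot I L C)) (hD : IsAssocModule I L (minusPart I L D)) (j : ℕ)
    (x : Ext (toAssoc _ hC) (toAssoc _ hD) j) : innerExtMap hC hD j x =
      ((Ext.mk₀ (toPlusQuot hC)).comp (x.mapExactFunctor (inflation I L))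
        (zero_add j)).comp (Ext.mk₀ (fromMinusPart hD)) (add_zero j) := rfl

theorem innerExtMap_bijective (hI : PathAlgebra.IsAdmissible I)
    {C D : RightMod (BoundAlgebra I)} (h : SupportedIn I (reach (heart V)) C)
    (hC : IsAssocModule I (heart V) (plusQuot I (heart V) C))
    (hD : IsAssocModule I (heart V) (minusPart I (heart V) D)) (j : ℕ) :
    Function.Bijective (innerExtMap hC hD j) :=
  (comp_fromMinusPart_bijective hI h hD j).comp
    ((toPlusQuot_comp_bijective hI hC (toAssoc _ hD) j).comp
      (mapExt_inflation_bijective hI (toAssoc _ hC) (toAssoc _ hD) j))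

theorem innerExtMap_naturality {C C' D D' : RightMod (BoundAlgebra I)} {L : Set V}
    (hC : IsAssocModule I L (plusQuot I L C)) (hC' : IsAssocModule I L (plusQuot I L C'))
    (hD : IsAssocModule I L (minusPart I L D)) (hD' : IsAssocModule I L (minusPart I L D'))
    (f : C' ⟶ C) (g : D ⟶ D') (j : ℕ) (x : Ext (toAssoc _ hC) (toAssoc _ hD) j) :
    innerExtMap hC' hD' j
        (((Ext.mk₀ (toAssocMap hC' hC (plusQuotMap L f))).comp x (zero_add j)).comp
          (Ext.mk₀ (toAssocMap hD hD' (minusPartMap L g))) (add_zero j)) =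
      ((Ext.mk₀ f).comp (innerExtMap hC hD j x) (zero_add j)).comp (Ext.mk₀ g) (add_zero j) := by
  have h1 := congrArg Ext.mk₀ (toPlusQuot_naturality hC' hC f)
  have h2 := congrArg Ext.mk₀ (fromMinusPart_naturality hD hD' g)
  rw [← Ext.mk₀_comp_mk₀, ← Ext.mk₀_comp_mk₀] at h1 h2
  rw [innerExtMap_apply, innerExtMap_apply, Ext.mapExactFunctor_comp, Ext.mapExactFunctor_comp,
    Ext.mapExactFunctor_mk₀, Ext.mapExactFunctor_mk₀]
  generalize x.mapExactFunctor (inflation I L) = y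
  generalize Ext.mk₀ ((inflation I L).map (toAssocMap hC' hC (plusQuotMap L f))) = a at h1 ⊢
  generalize Ext.mk₀ ((inflation I L).map (toAssocMap hD hD' (minusPartMap L g))) = b at h2 ⊢
  calc _ = (((Ext.mk₀ (toPlusQuot hC')).comp a (zero_add 0)).comp y (zero_add j)).comp
          (b.comp (Ext.mk₀ (fromMinusPart hD')) (zero_add 0)) (add_zero j) := by
        simp only [Ext.comp_assoc_of_second_deg_zero, Ext.comp_assoc_of_third_deg_zero]
    _ = _ := by
        rw [h1, h2]
        simp only [Ext.comp_assoc_of_second_deg_zero, Ext.comp_assoc_of_third_deg_zero]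

/-- The comparison map from Ext over `Γ` to Ext over `Λ`. -/
def extComparison {M N : RightMod (BoundAlgebra I)} (P : MinimalProjectiveResolution M)
    (J : MinimalInjectiveResolution N) {L : Set V} {n j l : ℕ}
    (hA : IsAssocModule I L (plusQuot I L (P.syzygy n)))
    (hB : IsAssocModule I L (minusPart I L (J.cosyzygy n))) (h : n + (j + n) = l) :
    Ext (toAssoc _ hA) (toAssoc _ hB) j →ₗ[K] Ext M N l where
  toFun x := (P.yonedaClass n).comp ((innerExtMap hA hB j x).comp (J.yonedaClass n) rfl) h
  map_add' x y := by rw [map_add, Ext.add_comp, Ext.comp_add]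
  map_smul' r x := by rw [map_smul, Ext.smul_comp, Ext.comp_smul, RingHom.id_apply]

theorem extComparison_apply {M N : RightMod (BoundAlgebra I)} (P : MinimalProjectiveResolution M)
    (J : MinimalInjectiveResolution N) {L : Set V} {n j l : ℕ}
    (hA : IsAssocModule I L (plusQuot I L (P.syzygy n)))
    (hB : IsAssocModule I L (minusPart I L (J.cosyzygy n))) (h : n + (j + n) = l)
    (x : Ext (toAssoc _ hA) (toAssoc _ hB) j) : extComparison P J hA hB h x =
      (P.yonedaClass n).comp ((innerExtMap hA hB j x).comp (J.yonedaClass n) rfl) h := rfl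

/-- Only the two dimension shifts need `1 ≤ j`; the inner comparison is bijective in every degree.
This is the source of the bound 2t+3. -/
theorem extComparison_bijective (hI : PathAlgebra.IsAdmissible I)
    {M N : RightMod (BoundAlgebra I)} (P : MinimalProjectiveResolution M)
    (J : MinimalInjectiveResolution N) {j l : ℕ} (hj : 1 ≤ j)
    (h : outerLength V + 1 + (j + (outerLength V + 1)) = l) :
    Function.Bijective (extComparison P J P.isAssocModule J.isAssocModule h) :=
  (P.yonedaClass_comp_bijective N _ (by omega) h).comp
    ((J.comp_yonedaClass_bijective _ _ hj rfl).comp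
      (innerExtMap_bijective hI P.supportedIn_syzygy P.isAssocModule J.isAssocModule j))

theorem extComparison_naturality {M M' N N' : RightMod (BoundAlgebra I)}
    {P : MinimalProjectiveResolution M} {P' : MinimalProjectiveResolution M'}
    {J : MinimalInjectiveResolution N} {J' : MinimalInjectiveResolution N'}
    {f : M' ⟶ M} {φ : P'.complex ⟶ P.complex} {g : N ⟶ N'} {ψ : J.cocomplex ⟶ J'.cocomplex}
    (hφ : P'.IsLift P f φ) (hψ : J.IsLift J' g ψ) {L : Set V} {n j l : ℕ}
    (hA : IsAssocModule I L (plusQuot I L (P.syzygy n)))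
    (hA' : IsAssocModule I L (plusQuot I L (P'.syzygy n)))
    (hB : IsAssocModule I L (minusPart I L (J.cosyzygy n)))
    (hB' : IsAssocModule I L (minusPart I L (J'.cosyzygy n))) (h : n + (j + n) = l)
    (x : Ext (toAssoc _ hA) (toAssoc _ hB) j) :
    extComparison P' J' hA' hB' h
        (((Ext.mk₀ (toAssocMap hA' hA (plusQuotMap L
            (MinimalProjectiveResolution.syzygyMap φ n)))).comp x (zero_add j)).comp
          (Ext.mk₀ (toAssocMap hB hB' (minusPartMap L
            (MinimalInjectiveResolution.cosyzygyMap ψ n)))) (add_zero j)) =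
      ((Ext.mk₀ f).comp (extComparison P J hA hB h x) (zero_add l)).comp (Ext.mk₀ g)
        (add_zero l) := by
  have h1 := MinimalProjectiveResolution.yonedaClass_naturality hφ n
  have h2 := MinimalInjectiveResolution.yonedaClass_naturality hψ n
  rw [extComparison_apply, extComparison_apply, innerExtMap_naturality]
  generalize innerExtMap hA hB j x = y
  generalize Ext.mk₀ (MinimalProjectiveResolution.syzygyMap φ n) = a at h1 ⊢
  generalize Ext.mk₀ (MinimalInjectiveResolution.cosyzygyMap ψ n) = b at h2 ⊢
  calc _ = ((P'.yonedaClass n).comp a (add_zero n)).comp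
        (y.comp (b.comp (J'.yonedaClass n) (zero_add n)) rfl) h := by
        simp only [Ext.comp_assoc_of_second_deg_zero, Ext.comp_assoc_of_third_deg_zero]
        rw [Ext.comp_assoc a _ _ _ _ (by omega), Ext.comp_assoc_of_second_deg_zero]
    _ = _ := by
        rw [h1, ← h2, Ext.comp_assoc (Ext.mk₀ f) _ _ _ h (by omega)]
        simp only [Ext.comp_assoc_of_third_deg_zero]

end Bound

/-! ### Finitely generated modules -/

theorem finite_quiverPath_length_eq {V : Type u} [Quiver.{u, u} V] [Fintype V]
    [∀ a b : V, Finite (a ⟶ b)] (k : ℕ) : Finite {q : QuiverPath V // q.2.2.length = k} := by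
  induction k with
  | zero =>
    refine Finite.of_surjective (fun v : V => ⟨⟨v, v, Quiver.Path.nil⟩, rfl⟩) ?_
    rintro ⟨⟨a, b, p⟩, hp⟩
    obtain rfl := Quiver.Path.eq_of_length_zero p hp
    obtain rfl := Quiver.Path.eq_nil_of_length_zero p hp
    exact ⟨_, rfl⟩
  | succ k ih =>
    refine Finite.of_surjective
      (fun x : Σ q : {q : QuiverPath V // q.2.2.length = k}, Σ c : V, (q.1.2.1 ⟶ c) =>
        ⟨⟨x.1.1.1, x.2.1, x.1.1.2.2.cons x.2.2⟩, congrArg (· + 1) x.1.2⟩) ?_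
    rintro ⟨⟨a, b, p⟩, hp⟩
    cases p with
    | nil => exact absurd hp (Nat.succ_ne_zero k).symm
    | cons p f => exact ⟨⟨⟨⟨a, _, p⟩, Nat.succ_injective hp⟩, _, f⟩, rfl⟩

/-- A module is finitely generated if it is so modulo a superfluous submodule. -/
theorem Module.Finite.of_isSuperfluous_ker {R M N : Type*} [Ring R] [AddCommGroup M] [Module R M]
    [AddCommGroup N] [Module R N] [Module.Finite R N] (f : M →ₗ[R] N)
    (hf : Function.Surjective f) (h : IsSuperfluous (LinearMap.ker f)) : Module.Finite R M := by
  obtain ⟨s, hs⟩ := (inferInstance : Module.Finite R N).fg_top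
  choose g hg using hf
  classical
  refine ⟨s.image g, h _ (eq_top_iff.2 fun x _ => ?_)⟩
  have hx : f x ∈ (Submodule.span R (s.image g : Set M)).map f := by
    rw [Submodule.map_span, Finset.coe_image, ← Set.image_comp]
    simp only [Function.comp_def, hg, Set.image_id', hs, Submodule.mem_top]
  obtain ⟨y, hy, hxy⟩ := hx
  rw [← sub_add_cancel x y]
  exact Submodule.add_mem_sup (by rw [LinearMap.mem_ker, map_sub, hxy, sub_self]) hy

/-- Stated for an additive map between modules over unrelated rings, so that it applies to the
identity map between a Γ-module and its inflation, in both directions. -/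
theorem Module.Finite.of_addMonoidHom_surjective {R S M N : Type*} [Semiring R] [Semiring S]
    [AddCommMonoid M] [AddCommMonoid N] [Module R M] [Module S N] [Module.Finite R M] (e : M →+ N)
    (he : Function.Surjective e) (h : ∀ (r : R) (m : M), ∃ s : S, e (r • m) = s • e m) :
    Module.Finite S N := by
  classical
  obtain ⟨s, hs⟩ := (inferInstance : Module.Finite R M).fg_top
  refine ⟨s.image e, eq_top_iff.2 fun x _ => ?_⟩
  obtain ⟨x, rfl⟩ := he x
  induction hs ▸ Submodule.mem_top (x := x) using Submodule.span_induction with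
  | mem x hx => exact Submodule.subset_span (Finset.mem_coe.2 (Finset.mem_image_of_mem e hx))
  | zero => rw [map_zero]; exact zero_mem _
  | add x y _ _ hx hy => rw [map_add]; exact add_mem (hx trivial) (hy trivial)
  | smul r x _ hx =>
    obtain ⟨t, ht⟩ := h r x
    rw [ht]
    exact Submodule.smul_mem _ t (hx trivial)

theorem MinimalProjectiveResolution.isSuperfluous_ker_pOpcycles {S : Type u} [Ring S]
    {M : ModuleCat.{u} S} (P : MinimalProjectiveResolution M) (n : ℕ) :
    IsSuperfluous (LinearMap.ker (P.complex.pOpcycles n).hom) := by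
  refine (P.minimal n).mono fun x hx => ?_
  have h := (ShortComplex.ShortExact.moduleCat_exact_iff_function_exact _).1
    (P.syzygyShortComplex_shortExact n).exact
  obtain ⟨y, hy⟩ := (h x).1 hx
  obtain ⟨z, rfl⟩ := (ModuleCat.epi_iff_surjective (P.complex.pOpcycles (n + 1))).1
    inferInstance y
  refine ⟨z, Eq.trans ?_ hy⟩
  exact congrArg (fun g => g.hom z) (P.complex.p_fromOpcycles (n + 1) n).symm

/-- A superfluous kernel passes finite generation from the syzygy up to the term covering it;
noetherianity passes it down to the next syzygy. -/
theorem MinimalProjectiveResolution.finite_syzygy {S : Type u} [Ring S] [IsNoetherianRing S]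
    {M : ModuleCat.{u} S} [Module.Finite S M] (P : MinimalProjectiveResolution M) (n : ℕ) :
    Module.Finite S (P.syzygy n) := by
  induction n with
  | zero => exact .equiv (asIso P.fromSyzygyZero).toLinearEquiv.symm
  | succ n ih =>
    have : Module.Finite S (P.complex.opcycles n) := ih
    have : Module.Finite S (P.complex.X n) := .of_isSuperfluous_ker (P.complex.pOpcycles n).hom
      ((ModuleCat.epi_iff_surjective _).1 inferInstance) (P.isSuperfluous_ker_pOpcycles n)
    have : Mono (P.complex.fromOpcycles (n + 1) n) := (P.syzygyShortComplex_shortExact n).mono_f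
    exact Module.Finite.of_injective (N := P.complex.X n)
      (P.complex.fromOpcycles (n + 1) n).hom ((ModuleCat.mono_iff_injective _).1 this)

/-! ### Projective dimension and Ext -/

section Dimension

variable {R : Type u} [Ring R]

theorem projDim_le_iff (M : RightMod R) (d : ℕ) :
    projDim M ≤ d ↔ ∀ i, d < i → ∀ N : RightMod R, Subsingleton (Ext M N i) := by
  -- Giving the zero module dimension 0 instead of ⊥ changes nothing here, as the bound `d` is a
  -- natural number.
  rw [projDim, WithBot.unbotD_le_iff fun _ => zero_le]
  refine (projectiveDimension_le_iff M d).trans ((hasProjectiveDimensionLT_iff M (d + 1)).trans ?_)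
  exact ⟨fun h i hi N => subsingleton_of_forall_eq 0 fun x => h i hi x,
    fun h i hi N x => (h i hi N).elim x 0⟩

theorem projDim_le_glDim (M : RightMod R) : projDim M ≤ glDim R := le_iSup (projDim ·) M

theorem projDim_le_finDim (M : RightMod R) (hM : Module.Finite Rᵐᵒᵖ M) (h : projDim M < ⊤) :
    projDim M ≤ finDim R :=
  le_iSup_of_le M (le_iSup_of_le hM (le_iSup_of_le h le_rfl))

end Dimension

section Bound

variable {K : Type u} [Field K] {V : Type u} [Quiver.{u, u} V] [Fintype V]
  {I : Ideal (PathAlgebra K V)} [I.IsTwoSided]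

theorem finite_boundAlgebra [∀ a b : V, Finite (a ⟶ b)] (hI : PathAlgebra.IsAdmissible I) :
    Module.Finite K (BoundAlgebra I) := by
  obtain ⟨-, n, -, hn⟩ := hI
  have (k : ℕ) := finite_quiverPath_length_eq (V := V) k
  let s : Set (BoundAlgebra I) := Set.range
    fun x : Σ k : Fin n, {q : QuiverPath V // q.2.2.length = k} => pathElt I x.2.1.2.2
  refine Module.Finite.of_fg_top (Submodule.fg_def.2 ⟨s, Set.finite_range _, eq_top_iff.2 fun r _ => ?_⟩)
  induction r using BoundAlgebra.induction with
  | zero => exact zero_mem _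
  | add x y hx hy => exact add_mem (hx trivial) (hy trivial)
  | @path c a b p =>
    refine Submodule.smul_mem _ c ?_
    by_cases hp : p.length < n
    · exact Submodule.subset_span ⟨⟨⟨p.length, hp⟩, ⟨a, b, p⟩, rfl⟩, rfl⟩
    · rw [pathElt_eq_zero hn p (not_lt.1 hp)]
      exact zero_mem _

theorem isNoetherianRing_op [∀ a b : V, Finite (a ⟶ b)] (hI : PathAlgebra.IsAdmissible I) :
    IsNoetherianRing (BoundAlgebra I)ᵐᵒᵖ := by
  have := finite_boundAlgebra hI
  have : Module.Finite K (BoundAlgebra I)ᵐᵒᵖ := .equiv (MulOpposite.opLinearEquiv K)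
  exact .of_finite K _

theorem finite_inflation {L : Set V} (A : RightMod (AssocAlgebra I L))
    [Module.Finite (AssocAlgebra I L)ᵐᵒᵖ A] :
    Module.Finite (BoundAlgebra I)ᵐᵒᵖ ((inflation I L).obj A) :=
  .of_addMonoidHom_surjective (R := (AssocAlgebra I L)ᵐᵒᵖ) (AddMonoidHom.id A)
    Function.surjective_id fun r _ => (assocMap_surjective I L r).imp fun _ hs => by rw [← hs]; rfl

theorem finite_toAssoc {L : Set V} {C : RightMod (BoundAlgebra I)} (h : IsAssocModule I L C)
    [Module.Finite (BoundAlgebra I)ᵐᵒᵖ C] :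
    Module.Finite (AssocAlgebra I L)ᵐᵒᵖ (toAssoc C h) :=
  .of_addMonoidHom_surjective (R := (BoundAlgebra I)ᵐᵒᵖ) (M := C) (AddMonoidHom.id C)
    Function.surjective_id fun r _ => ⟨assocMap I L r, rfl⟩

/-! ### Homological dimensions of `Λ` and `Γ` -/

theorem projDim_le_of_inflation (hI : PathAlgebra.IsAdmissible I)
    {A : RightMod (AssocAlgebra I (heart V))} {d : ℕ}
    (h : projDim ((inflation I (heart V)).obj A) ≤ d) : projDim A ≤ d := by
  rw [projDim_le_iff] at h ⊢
  intro i hi B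
  have := h i hi ((inflation I (heart V)).obj B)
  exact (mapExt_inflation_bijective hI A B i).injective.subsingleton

/-- A module inflated from Γ already lives on the heart, so only the second variable has to be
replaced. The estimate ensures that inflation preserves finiteness of projective dimension. -/
theorem projDim_inflation_le (hI : PathAlgebra.IsAdmissible I)
    {A : RightMod (AssocAlgebra I (heart V))} {d : ℕ} (h : projDim A ≤ d) :
    projDim ((inflation I (heart V)).obj A) ≤ (d + (outerLength V + 1) : ℕ) := by
  rw [projDim_le_iff] at h ⊢
  intro i hi N
  obtain ⟨J⟩ := nonempty_minimalInjectiveResolution N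
  obtain ⟨j, rfl⟩ : ∃ j, i = j + (outerLength V + 1) := ⟨i - (outerLength V + 1), by omega⟩
  have := h j (by omega) (toAssoc _ J.isAssocModule)
  exact ((J.comp_yonedaClass_bijective _ _ (show 1 ≤ j by omega) rfl).comp
    ((comp_fromMinusPart_bijective hI ((supportedIn_inflation I A).mono (subset_reach _))
      J.isAssocModule j).comp (mapExt_inflation_bijective hI A _ j))).surjective.subsingleton

/-- Against inflated modules only the first variable needs shifting, and that shift raises the
degree, so vanishing above `d` for `M` is more than enough. -/
theorem projDim_toAssoc_plusQuot_le (hI : PathAlgebra.IsAdmissible I)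
    {M : RightMod (BoundAlgebra I)} (P : MinimalProjectiveResolution M) {d : ℕ}
    (h : projDim M ≤ d) : projDim (toAssoc _ P.isAssocModule) ≤ d := by
  rw [projDim_le_iff] at h ⊢
  intro j hj B
  have := h (outerLength V + 1 + j) (by omega) ((inflation I (heart V)).obj B)
  exact ((P.yonedaClass_comp_bijective _ _ (show 1 ≤ j by omega) rfl).comp
    ((toPlusQuot_comp_bijective hI P.isAssocModule B j).comp
      (mapExt_inflation_bijective hI _ B j))).injective.subsingleton

theorem projDim_le_of_toAssoc_plusQuot (hI : PathAlgebra.IsAdmissible I)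
    {M : RightMod (BoundAlgebra I)} (P : MinimalProjectiveResolution M) {d : ℕ}
    (h : projDim (toAssoc _ P.isAssocModule) ≤ d) :
    projDim M ≤ (d + (2 * outerLength V + 2) : ℕ) := by
  rw [projDim_le_iff] at h ⊢
  intro l hl N
  obtain ⟨J⟩ := nonempty_minimalInjectiveResolution N
  have := h (l - (2 * outerLength V + 2)) (by omega) (toAssoc _ J.isAssocModule)
  exact (extComparison_bijective hI P J (j := l - (2 * outerLength V + 2)) (l := l) (by omega)
    (by omega)).surjective.subsingleton

theorem projDim_le_add (hI : PathAlgebra.IsAdmissible I)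
    {M : RightMod (BoundAlgebra I)} (P : MinimalProjectiveResolution M) :
    projDim M ≤ projDim (toAssoc _ P.isAssocModule) + (2 * outerLength V + 2 : ℕ) := by
  cases h : projDim (toAssoc _ P.isAssocModule) with
  | top => simp
  | coe d => exact mod_cast projDim_le_of_toAssoc_plusQuot hI P h.le

theorem glDim_lt_top_iff (hI : PathAlgebra.IsAdmissible I) :
    glDim (BoundAlgebra I) < ⊤ ↔ glDim (AssocAlgebra I (heart V)) < ⊤ := by
  constructor
  · intro h
    obtain ⟨d, hd⟩ := ENat.ne_top_iff_exists.1 h.ne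
    refine (iSup_le fun A => projDim_le_of_inflation hI (d := d) ?_).trans_lt (ENat.natCast_lt_top d)
    rw [hd]
    exact projDim_le_glDim _
  · intro h
    obtain ⟨d, hd⟩ := ENat.ne_top_iff_exists.1 h.ne
    refine (iSup_le fun M => ?_).trans_lt (ENat.natCast_lt_top (d + (2 * outerLength V + 2)))
    obtain ⟨P⟩ := hI.nonempty_minimalProjectiveResolution M
    refine projDim_le_of_toAssoc_plusQuot hI P ?_
    rw [hd]
    exact projDim_le_glDim _

/-- Inflation keeps a finite projective dimension finite and never lowers it, since Ext over Γ
embeds into Ext over Λ. -/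
theorem finDim_assocAlgebra_le (hI : PathAlgebra.IsAdmissible I) :
    finDim (AssocAlgebra I (heart V)) ≤ finDim (BoundAlgebra I) := by
  refine iSup_le fun A => iSup_le fun hA => iSup_le fun h => ?_
  obtain ⟨d, hd⟩ := ENat.ne_top_iff_exists.1 h.ne
  have hlt := (projDim_inflation_le hI hd.ge).trans_lt (ENat.natCast_lt_top _)
  obtain ⟨d', hd'⟩ := ENat.ne_top_iff_exists.1 hlt.ne
  refine (projDim_le_of_inflation hI hd'.ge).trans ?_
  rw [hd']
  exact projDim_le_finDim _ (finite_inflation A) hlt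

theorem finDim_boundAlgebra_le [∀ a b : V, Finite (a ⟶ b)] (hI : PathAlgebra.IsAdmissible I) :
    finDim (BoundAlgebra I) ≤
      finDim (AssocAlgebra I (heart V)) + (2 * outerLength V + 2 : ℕ) := by
  have := isNoetherianRing_op hI
  refine iSup_le fun M => iSup_le fun hM => iSup_le fun h => ?_
  obtain ⟨d, hd⟩ := ENat.ne_top_iff_exists.1 h.ne
  obtain ⟨P⟩ := hI.nonempty_minimalProjectiveResolution M
  refine (projDim_le_add hI P).trans (add_le_add_left (projDim_le_finDim _ ?_
    ((projDim_toAssoc_plusQuot_le hI P hd.ge).trans_lt (ENat.natCast_lt_top _))) _)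
  have := P.finite_syzygy (outerLength V + 1)
  have : Module.Finite (BoundAlgebra I)ᵐᵒᵖ
      (plusQuot I (heart V) (P.syzygy (outerLength V + 1))) :=
    inferInstanceAs (Module.Finite _ (_ ⧸ plusSub I (heart V) (P.syzygy (outerLength V + 1))))
  exact finite_toAssoc _

theorem finDim_lt_top_iff [∀ a b : V, Finite (a ⟶ b)] (hI : PathAlgebra.IsAdmissible I) :
    finDim (BoundAlgebra I) < ⊤ ↔ finDim (AssocAlgebra I (heart V)) < ⊤ :=
  ⟨(finDim_assocAlgebra_le hI).trans_lt, fun h => (finDim_boundAlgebra_le hI).trans_lt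
    (ENat.add_lt_top.2 ⟨h, ENat.natCast_lt_top _⟩)⟩

end Bound

end

theorem theorem5p9 {K : Type u} [Field K] {V : Type u} [Quiver.{u, u} V] [Fintype V]
    [∀ a b : V, Finite (a ⟶ b)] (I : Ideal (PathAlgebra K V)) [I.IsTwoSided]
    (hI : PathAlgebra.IsAdmissible I) (H : Set V) (hH : H = FullSubquiver.heart V)
    (t : ℕ) (ht : t = FullSubquiver.outerLength V) :
    (glDim (BoundAlgebra I) < ⊤ ↔ glDim (AssocAlgebra I H) < ⊤) ∧
    (finDim (BoundAlgebra I) < ⊤ ↔ finDim (AssocAlgebra I H) < ⊤) ∧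
    finDim (BoundAlgebra I) ≤ finDim (AssocAlgebra I H) + (2 * t + 2 : ℕ) ∧
    (∀ M : RightMod (BoundAlgebra I), Nonempty (MinimalProjectiveResolution M)) ∧
    (∀ N : RightMod (BoundAlgebra I), Nonempty (MinimalInjectiveResolution N)) ∧
    ∃ (hA : ∀ (M : RightMod (BoundAlgebra I)) (P : MinimalProjectiveResolution M),
        IsAssocModule I H (plusQuot I H (P.syzygy (t + 1))))
      (hB : ∀ (N : RightMod (BoundAlgebra I)) (J : MinimalInjectiveResolution N),
        IsAssocModule I H (minusPart I H (J.cosyzygy (t + 1))))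
      (Φ : ∀ (M N : RightMod (BoundAlgebra I)) (P : MinimalProjectiveResolution M)
        (J : MinimalInjectiveResolution N) (l : ℕ), 2 * t + 3 ≤ l →
        (Ext M N l ≃ₗ[K] Ext (toAssoc _ (hA M P)) (toAssoc _ (hB N J)) (l - (2 * t + 2)))),
      ∀ (M M' N N' : RightMod (BoundAlgebra I)) (P : MinimalProjectiveResolution M)
        (P' : MinimalProjectiveResolution M') (J : MinimalInjectiveResolution N)
        (J' : MinimalInjectiveResolution N') (f : M' ⟶ M) (φ : P'.complex ⟶ P.complex)
        (g : N ⟶ N') (ψ : J.cocomplex ⟶ J'.cocomplex), P'.IsLift P f φ → J.IsLift J' g ψ →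
        ∀ (l : ℕ) (hl : 2 * t + 3 ≤ l) (x : Ext M N l),
          Φ M' N' P' J' l hl
              (((Ext.mk₀ f).comp x (zero_add l)).comp (Ext.mk₀ g) (add_zero l)) =
            ((Ext.mk₀ (toAssocMap (hA M' P') (hA M P)
                (plusQuotMap H (MinimalProjectiveResolution.syzygyMap φ (t + 1))))).comp
              (Φ M N P J l hl x) (zero_add _)).comp
              (Ext.mk₀ (toAssocMap (hB N J) (hB N' J')
                (minusPartMap H (MinimalInjectiveResolution.cosyzygyMap ψ (t + 1)))))
              (add_zero _) := by
  subst hH ht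
  refine ⟨glDim_lt_top_iff hI, finDim_lt_top_iff hI, finDim_boundAlgebra_le hI,
    hI.nonempty_minimalProjectiveResolution, nonempty_minimalInjectiveResolution,
    fun M P => P.isAssocModule, fun N J => J.isAssocModule,
    -- The isomorphism is the inverse of the comparison map, so naturality is checked after applying
    -- that map to both sides.
    fun M N P J l hl => (LinearEquiv.ofBijective
      (extComparison P J P.isAssocModule J.isAssocModule (by omega))
      (extComparison_bijective hI P J (by omega) (by omega))).symm, ?_⟩
  intro M M' N N' P P' J J' f φ g ψ hφ hψ l hl x
  rw [LinearEquiv.symm_apply_eq]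
  refine Eq.trans ?_ (extComparison_naturality hφ hψ P.isAssocModule P'.isAssocModule
    J.isAssocModule J'.isAssocModule (by omega) _).symm
  have h : extComparison P J P.isAssocModule J.isAssocModule
      (j := l - (2 * FullSubquiver.outerLength V + 2)) (l := l) (by omega) _ = x := (LinearEquiv.ofBijective _
    (extComparison_bijective hI P J (by omega) (by omega))).apply_symm_apply x
  rw [h]
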